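/- Let $S^2\subset\mathbb R^3$ be the unit sphere with coordinates $(x,y,z)$, let $\omega$ be the Euclidean area form divided by $4\pi$ (so that $S^2$ has total area $1$), and let $C(S^2)$ be the space of continuous functions $S^2\to\mathbb R$ with the uniform norm $\|\cdot\|$. The Hamiltonian vector field $X_F$ of a smooth function $F$ is given by $\omega(X_F,\cdot)=dF$, and $\{F,G\}=\omega(X_F,X_G)$. Call a function $F:S^2\to\mathbb R$ generic if it is smooth, its critical points are isolated, its Hessian is nondegenerate at each critical point, and its values at distinct critical points are distinct. For generic $F$ let $\Gamma_F$ be its Reeb graph, that is, the quotient space obtained from $S^2$ by collapsing each connected component of each level set of $F$ to a point, and let $\sigma_F$ be the image on $\Gamma_F$ of the normalized area measure. A median of $\Gamma_F$ is a point $m\in\Gamma_F$ such that every connected component of $\Gamma_F\setminus\{m\}$ has $\sigma_F$-measure at most $1/2$. 1. For every generic $F$ there is exactly one median $m_F\in\Gamma_F$. Let $\zeta(F)$ be the value of $F$ on the level component corresponding to $m_F$. 2. The functional $\zeta$, so defined on generic functions, has exactly one continuous extension $\zeta:C(S^2)\to\mathbb R$. 3. The extension $\zeta$ is a quasi-state,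 that is: $\zeta(F)\ge 0$ whenever $F\ge 0$; $\zeta(1)=1$; and $\zeta(aF+bG)=a\,\zeta(F)+b\,\zeta(G)$ for all $a,b\in\mathbb R$ and all smooth $F,G$ with $\{F,G\}\equiv 0$. Moreover, $\zeta(F)\le\zeta(G)$ whenever $F\le G$, and $|\zeta(F)-\zeta(G)|\le\|F-G\|$, for all $F,G\in C(S^2)$. 4. The functional $\zeta$ is not linear; indeed $$\zeta(x^2+y^2)-\zeta(x^2)-\zeta(y^2)=1 .$$ -/

import Mathlib

open MeasureTheory Topology
open scoped Manifold ContDiff Matrix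

noncomputable section

namespace MedianSphere

/-- Euclidean three-space. -/
abbrev E3 : Type := EuclideanSpace ℝ (Fin 3)

/-- The unit sphere in Euclidean three-space. -/
abbrev S2 : Type := Metric.sphere (0 : E3) 1

/-- Euclidean surface measure on the unit sphere, divided by `4π`. -/
def area : Measure S2 :=
  ENNReal.ofReal (4 * Real.pi)⁻¹ • (volume : Measure E3).toSphere

/-! ### Calculus on the sphere -/

/-- Smooth (infinitely differentiable) functions on the sphere. -/
def IsSmooth (F : C(S2, ℝ)) : Prop :=
  ContMDiff (𝓡 2) 𝓘(ℝ, ℝ) ∞ F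

/-- The extension of a function on the sphere to `ℝ³ ∖ {0}` that is constant on rays, with
the irrelevant value `0` at the origin. -/
def radialExtension (F : C(S2, ℝ)) (x : E3) : ℝ :=
  open Classical in
  if h : x ≠ 0 then F ⟨‖x‖⁻¹ • x, by simp [norm_smul, h]⟩ else 0

/-- The gradient of `F` at `p` for the Riemannian metric induced from `ℝ³`. The derivative at `p`
of the radial extension is `dF` on the tangent plane `pᗮ` and vanishes in the direction of `p`,
so the ambient gradient is tangent to the sphere. -/
def grad (F : C(S2, ℝ)) (p : S2) : E3 :=
  gradient (radialExtension F) (p : E3)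

/-- `p` is a critical point of `F`. -/
def IsCritical (F : C(S2, ℝ)) (p : S2) : Prop :=
  grad F p = 0

/-- The second derivative at `p` of the radial extension, as a bilinear form. At a critical
point `p`, its restriction to the tangent plane `pᗮ` is the Hessian of `F` at `p`. -/
def hess (F : C(S2, ℝ)) (p : S2) (u v : E3) : ℝ :=
  fderiv ℝ (fderiv ℝ (radialExtension F)) (p : E3) u v

/-- Generic functions: smooth, with isolated critical points, with nondegenerate Hessian (on
the tangent plane) at each of them, and with distinct values at distinct critical points. -/
structure IsGeneric (F : C(S2, ℝ)) : Prop where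
  smooth : IsSmooth F
  isolated : ∀ p, IsCritical F p → ∀ᶠ q in 𝓝[≠] p, ¬ IsCritical F q
  nondegenerate : ∀ p, IsCritical F p → ∀ u : E3, inner ℝ (p : E3) u = 0 →
    (∀ v : E3, inner ℝ (p : E3) v = 0 → hess F p u v = 0) → u = 0
  distinct_values : ∀ p q, IsCritical F p → IsCritical F q → F p = F q → p = q

/-! ### The Poisson bracket -/

/-- The normalized area form `ω_p(u, v) = det(p, u, v) / 4π`, for `u`, `v` tangent to the sphere
at `p`. -/
def areaForm (p : S2) (u v : E3) : ℝ :=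
  (4 * Real.pi)⁻¹ * (Matrix.of ![(p : E3).ofLp, u.ofLp, v.ofLp]).det

/-- The Hamiltonian vector field of `F`: the tangent field `X` with `ω(X, ·) = dF`. -/
def hamiltonianField (F : C(S2, ℝ)) (p : S2) : E3 :=
  (4 * Real.pi) • WithLp.toLp 2 ((grad F p).ofLp ⨯₃ (p : E3).ofLp)

/-- The Hamiltonian field is tangent to the sphere. -/
theorem inner_hamiltonianField (F : C(S2, ℝ)) (p : S2) :
    inner ℝ (p : E3) (hamiltonianField F p) = 0 := by
  simp [hamiltonianField, PiLp.inner_apply, Fin.sum_univ_three, cross_apply]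
  ring

/-- The defining relation `ω(X, v) = dF(v)` for tangent vectors `v`. -/
theorem areaForm_hamiltonianField (F : C(S2, ℝ)) (p : S2) (v : E3)
    (hv : inner ℝ (p : E3) v = 0) :
    areaForm p (hamiltonianField F p) v = inner ℝ (grad F p) v := by
  have hp : ‖(p : E3)‖ ^ 2 = 1 := by simp
  rw [EuclideanSpace.norm_sq_eq] at hp
  simp only [PiLp.inner_apply, Fin.sum_univ_three, Real.norm_eq_abs, sq_abs,
    RCLike.inner_apply, conj_trivial] at hp hv ⊢
  have h4 : (4 * Real.pi)⁻¹ * (4 * Real.pi) = 1 := inv_mul_cancel₀ (by positivity)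
  simp [areaForm, hamiltonianField, Matrix.det_fin_three, cross_apply, -mul_inv_rev]
  generalize (4 * Real.pi)⁻¹ = c at *
  generalize (p : E3).ofLp = x, (grad F p).ofLp = g, v.ofLp = w at *
  linear_combination (x 0 ^ 2 + x 1 ^ 2 + x 2 ^ 2) * (w 0 * g 0 + w 1 * g 1 + w 2 * g 2) * h4
    + (w 0 * g 0 + w 1 * g 1 + w 2 * g 2) * hp
    - c * (4 * Real.pi) * (x 0 * g 0 + x 1 * g 1 + x 2 * g 2) * hv

/-- The Poisson bracket `{F, G} = ω(X_F, X_G) = dF(X_G)`. -/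
def poissonBracket (F G : C(S2, ℝ)) (p : S2) : ℝ :=
  areaForm p (hamiltonianField F p) (hamiltonianField G p)

/-- Smooth functions whose Poisson bracket vanishes identically. -/
def PoissonCommute (F G : C(S2, ℝ)) : Prop :=
  IsSmooth F ∧ IsSmooth G ∧ ∀ p, poissonBracket F G p = 0

/-! ### The Reeb graph and its median -/

/-- Two points are equivalent if they lie in the same connected component of a level set. -/
def levelSetoid (F : C(S2, ℝ)) : Setoid S2 where
  r p q := q ∈ connectedComponentIn (F ⁻¹' {F p}) p
  iseqv := by
    have key : ∀ p q : S2, q ∈ connectedComponentIn (F ⁻¹' {F p}) p →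
        connectedComponentIn (F ⁻¹' {F q}) q = connectedComponentIn (F ⁻¹' {F p}) p := by
      intro p q h
      have h1 : F q = F p := connectedComponentIn_subset (F ⁻¹' {F p}) p h
      rw [h1]
      exact (connectedComponentIn_eq h).symm
    refine ⟨fun p => mem_connectedComponentIn rfl, fun {p q} h => ?_, fun {p q r} h h' => ?_⟩
    · rw [key p q h]
      exact mem_connectedComponentIn rfl
    · rwa [key p q h] at h'

/-- The Reeb graph: the sphere with each connected component of each level set collapsed to a
point, with the quotient topology. -/
def ReebGraph (F : C(S2, ℝ)) : Type := Quotient (levelSetoid F)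

instance (F : C(S2, ℝ)) : TopologicalSpace (ReebGraph F) :=
  inferInstanceAs (TopologicalSpace (Quotient (levelSetoid F)))

instance (F : C(S2, ℝ)) : MeasurableSpace (ReebGraph F) := borel _

instance (F : C(S2, ℝ)) : BorelSpace (ReebGraph F) := ⟨rfl⟩

/-- The projection of the sphere onto the Reeb graph. -/
def toReeb (F : C(S2, ℝ)) : S2 → ReebGraph F := Quotient.mk (levelSetoid F)

/-- The probability measure on the Reeb graph that gives a Borel set (for instance an open
interval on an edge) the area of the part of the sphere lying over it. -/
def reebMeasure (F : C(S2, ℝ)) : Measure (ReebGraph F) := area.map (toReeb F)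

/-- `m` is a median: after removing `m`, each connected component has measure at most `1/2`. -/
def IsMedian (F : C(S2, ℝ)) (m : ReebGraph F) : Prop :=
  ∀ a : ReebGraph F, a ≠ m → reebMeasure F (connectedComponentIn {m}ᶜ a) ≤ 1 / 2

/-! ### Quasi-states -/

/-- `ζ` is an extension by continuity (for the uniform norm) of the functional that sends a
generic function `F` to its value on the level component over the median of its Reeb graph. -/
structure IsMedianExtension (ζ : C(S2, ℝ) → ℝ) : Prop where
  continuous : Continuous ζ
  value : ∀ F, IsGeneric F → ∀ p : S2, IsMedian F (toReeb F p) → ζ F = F p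

/-- Quasi-states on the continuous functions on the sphere. -/
structure IsQuasiState (ζ : C(S2, ℝ) → ℝ) : Prop where
  positivity : ∀ F, 0 ≤ F → 0 ≤ ζ F
  normalization : ζ 1 = 1
  quasi_linearity : ∀ (a b : ℝ) (F G : C(S2, ℝ)), PoissonCommute F G →
    ζ (a • F + b • G) = a * ζ F + b * ζ G

/-- The restriction to the sphere of the `i`-th coordinate function. -/
def coord (i : Fin 3) : C(S2, ℝ) where
  toFun p := (p : E3) i
  continuous_toFun := by fun_prop

end MedianSphere

end

/-! ### Median continua in a probability space -/

section MedianContinua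

open Set

/-! The Reeb graph is replaced by median continua: closed connected sets all of whose complementary
components have area at most 1/2. A point of the Reeb graph is a median exactly when its level
component is such a continuum (`isMedian_iff`). Everything rests on two facts.

Any two median continua meet (`IsMedianContinuum.inter_nonempty`). Hence the median is unique, and
for any two continuous functions some point carries both median values. Monotonicity and the
Lipschitz bound follow by evaluating at that point.

If the image of a pair (F, G) is null in the plane, then F and G are both constant on one median
continuum (`IsUnicoherent.exists_median_eq_const_prod`). The source is unicoherence of the sphere:
when two closed sets cover it, one of them contains a median continuum. This is applied to small
neighbourhoods of a fine grid of lines in the plane, followed by a limit of nested continua. With G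
= 0 it yields the median of an arbitrary continuous F. For Poisson commuting F and G the map (F, G)
has rank less than 2, so its image is null; the common continuum then gives quasi-linearity.

Uniqueness of the extension is density of generic functions: approximate by a smooth function, add a
small linear function chosen by Sard's theorem to make critical points nondegenerate, then separate
critical values by a function locally constant near them. Nonlinearity comes from great circles,
which are median continua. -/

theorem IsPreconnected.subset_or_disjoint_of_disjoint_frontier {X : Type*} [TopologicalSpace X]
    {s u : Set X} (hs : IsPreconnected s) (h : Disjoint s (frontier u)) : s ⊆ u ∨ Disjoint s u := by
  by_contra! hc
  obtain ⟨h1, h2⟩ := hc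
  rw [Set.not_disjoint_iff] at h2
  obtain ⟨y, hys, hyu⟩ := h2
  obtain ⟨x, hxs, hxu⟩ := Set.not_subset.1 h1
  have hi : ∀ z ∈ s, z ∈ u → z ∈ interior u := fun z hz hzu => by
    by_contra hzi
    exact Set.disjoint_left.1 h hz ⟨subset_closure hzu, hzi⟩
  have hc : ∀ z ∈ s, z ∉ u → z ∈ (closure u)ᶜ := fun z hz hzu hzc =>
    Set.disjoint_left.1 h hz ⟨hzc, fun hh => hzu (interior_subset hh)⟩
  obtain ⟨z, -, hz1, hz2⟩ := hs (interior u) (closure u)ᶜ isOpen_interior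
    isClosed_closure.isOpen_compl
    (fun z hz => by
      by_cases hzu : z ∈ u
      · exact Or.inl (hi z hz hzu)
      · exact Or.inr (hc z hz hzu)) ⟨y, hys, hi y hys hyu⟩ ⟨x, hxs, hc x hxs hxu⟩
  exact hz2 (subset_closure (interior_subset hz1))

/-- By compactness, disjoint open sets separating the intersection already cover, and so separate,
some `C n`. -/
theorem IsPreconnected.iInter_antitone {X : Type*} [TopologicalSpace X] [CompactSpace X] [T2Space X]
    {C : ℕ → Set X} (hC : Antitone C) (hcl : ∀ n, IsClosed (C n))
    (hconn : ∀ n, IsPreconnected (C n)) : IsPreconnected (⋂ n, C n) := by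
  have hcli : IsClosed (⋂ n, C n) := isClosed_iInter hcl
  rw [isPreconnected_closed_iff]
  intro t t' ht ht' hcov ⟨x, hx, hxt⟩ ⟨y, hy, hyt⟩
  by_contra hne
  have hd : Disjoint ((⋂ n, C n) ∩ t) ((⋂ n, C n) ∩ t') := by
    rw [Set.disjoint_left]
    rintro z ⟨hz, hzt⟩ ⟨-, hzt'⟩
    exact hne ⟨z, hz, hzt, hzt'⟩
  obtain ⟨u, v, hu, hv, htu, htv, huv⟩ :=
    normal_separation (hcli.inter ht) (hcli.inter ht') hd
  obtain ⟨n, hn⟩ : ∃ n, C n ⊆ u ∪ v := by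
    refine exists_subset_nhds_of_isCompact hC.directed_ge (fun n => (hcl n).isCompact) ?_
    intro z hz
    refine (hu.union hv).mem_nhds ?_
    rcases hcov hz with h | h
    · exact Or.inl (htu ⟨hz, h⟩)
    · exact Or.inr (htv ⟨hz, h⟩)
  obtain ⟨z, -, hzu, hzv⟩ := hconn n u v hu hv hn
    ⟨x, Set.mem_iInter.1 hx n, htu ⟨hx, hxt⟩⟩ ⟨y, Set.mem_iInter.1 hy n, htv ⟨hy, hyt⟩⟩
  exact Set.disjoint_left.1 huv hzu hzv

theorem IsClosed.connectedComponentIn {X : Type*} [TopologicalSpace X] {A : Set X}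
    (hA : IsClosed A) {x : X} : IsClosed (connectedComponentIn A x) := by
  by_cases hx : x ∈ A
  · refine isClosed_of_closure_subset ?_
    exact isPreconnected_connectedComponentIn.closure.subset_connectedComponentIn
      (subset_closure (mem_connectedComponentIn hx))
      (closure_minimal (connectedComponentIn_subset A x) hA)
  · rw [connectedComponentIn_eq_empty hx]
    exact isClosed_empty

/-- The complement of a component of the complement of a connected set is connected. -/
theorem isPreconnected_compl_connectedComponentIn_compl {X : Type*} [TopologicalSpace X]
    [LocallyConnectedSpace X] [PreconnectedSpace X] {C : Set X} (hC : IsClosed C)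
    (hconn : IsConnected C) (a : X) : IsPreconnected (connectedComponentIn Cᶜ a)ᶜ := by
  obtain ⟨c, hc⟩ := hconn.nonempty
  refine isPreconnected_of_forall c fun y hy => ?_
  by_cases hyC : y ∈ C
  · refine ⟨C, ?_, hc, hyC, hconn.isPreconnected⟩
    exact fun z hz hza => connectedComponentIn_subset _ _ hza hz
  set W := connectedComponentIn Cᶜ y with hW
  have hyW : y ∈ W := mem_connectedComponentIn hyC
  have hWo : IsOpen W := hC.isOpen_compl.connectedComponentIn
  have hWa : Disjoint W (connectedComponentIn Cᶜ a) := by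
    rw [Set.disjoint_left]
    intro z hz hza
    apply hy
    rw [connectedComponentIn_eq hza, ← connectedComponentIn_eq hz]
    exact hyW
  -- A frontier point of another component `W` must lie in `C`, so `W` is attached to `C` through
  -- it.
  obtain ⟨x, hx⟩ : (frontier W).Nonempty := by
    rw [nonempty_frontier_iff]
    refine ⟨⟨y, hyW⟩, fun h => ?_⟩
    exact connectedComponentIn_subset Cᶜ y (h ▸ mem_univ c : c ∈ W) hc
  have hxW : x ∉ W := by rw [hWo.frontier_eq] at hx; exact hx.2
  have hxcl : x ∈ closure W := hx.1
  have hins : IsPreconnected (insert x W) :=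
    isPreconnected_connectedComponentIn.subset_closure (Set.subset_insert _ _)
      (Set.insert_subset hxcl subset_closure)
  have hxC : x ∈ C := by
    by_contra hxC
    refine hxW (hins.subset_connectedComponentIn (Set.mem_insert_of_mem _ hyW) ?_
      (Set.mem_insert _ _))
    exact Set.insert_subset hxC (connectedComponentIn_subset _ _)
  refine ⟨C ∪ insert x W, ?_, Or.inl hc, Or.inr (Set.mem_insert_of_mem _ hyW),
    hconn.isPreconnected.union x hxC (Set.mem_insert _ _) hins⟩
  rintro z (hz | rfl | hz) hza
  · exact connectedComponentIn_subset _ _ hza hz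
  · exact connectedComponentIn_subset _ _ hza hxC
  · exact Set.disjoint_left.1 hWa hz hza

theorem not_disjoint_of_half_lt_measure {X : Type*} [MeasurableSpace X] {μ : Measure X}
    [IsProbabilityMeasure μ] {s t : Set X} (ht : MeasurableSet t) (hs' : 1 / 2 < μ s)
    (ht' : 1 / 2 < μ t) : ¬ Disjoint s t := by
  intro hd
  have h := measure_union hd ht (μ := μ)
  have h1 : μ (s ∪ t) ≤ 1 := prob_le_one
  rw [h] at h1
  have h2 := ENNReal.add_lt_add hs' ht'
  rw [ENNReal.add_halves] at h2
  exact absurd h1 (not_le.2 h2)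

variable {X : Type*} [TopologicalSpace X] [MeasurableSpace X]

/-- A continuum all of whose complementary components have measure at most one half. -/
structure IsMedianContinuum (μ : Measure X) (C : Set X) : Prop where
  isClosed : IsClosed C
  isConnected : IsConnected C
  measure_le : ∀ a ∉ C, μ (connectedComponentIn Cᶜ a) ≤ 1 / 2

variable {μ : Measure X}

theorem IsMedianContinuum.superset {C C' : Set X} (h : IsMedianContinuum μ C) (hC : C ⊆ C')
    (hcl : IsClosed C') (hconn : IsPreconnected C') : IsMedianContinuum μ C' :=
  ⟨hcl, ⟨h.isConnected.nonempty.mono hC, hconn⟩, fun a ha =>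
    (measure_mono (connectedComponentIn_mono a (Set.compl_subset_compl.2 hC))).trans
      (h.measure_le a fun haC => ha (hC haC))⟩

section

variable [BorelSpace X] [LocallyConnectedSpace X] [PreconnectedSpace X]
  [IsProbabilityMeasure μ]

/-- If `C` and `C'` were disjoint, let `U` be the complementary component of `C` containing `C'`,
and `V` that of `C'` containing `C`. The complement of `U` is connected and misses `C'`, so it lies
in `V`, and `U`, `V` cover the space. Both have measure at most 1/2, so their open overlap is null,
hence empty, against connectedness. -/
theorem IsMedianContinuum.inter_nonempty [μ.IsOpenPosMeasure] {C C' : Set X}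
    (h : IsMedianContinuum μ C) (h' : IsMedianContinuum μ C') : (C ∩ C').Nonempty := by
  by_contra hne
  have hd : Disjoint C C' := Set.disjoint_iff_inter_eq_empty.2 (Set.not_nonempty_iff_eq_empty.1 hne)
  obtain ⟨c, hc⟩ := h.isConnected.nonempty
  obtain ⟨c', hc'⟩ := h'.isConnected.nonempty
  have hcC' : c ∉ C' := Set.disjoint_left.1 hd hc
  have hcC : c' ∉ C := Set.disjoint_right.1 hd hc'
  set U := connectedComponentIn Cᶜ c' with hU
  set V := connectedComponentIn C'ᶜ c with hV
  have hUo : IsOpen U := h.isClosed.isOpen_compl.connectedComponentIn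
  have hVo : IsOpen V := h'.isClosed.isOpen_compl.connectedComponentIn
  have hCU : C' ⊆ U := h'.isConnected.isPreconnected.subset_connectedComponentIn hc'
    (Set.disjoint_right.1 hd)
  have hUV : Uᶜ ⊆ V := by
    refine (isPreconnected_compl_connectedComponentIn_compl h.isClosed h.isConnected
      c').subset_connectedComponentIn ?_ (Set.compl_subset_compl.2 hCU)
    exact fun hcU => connectedComponentIn_subset _ _ hcU hc
  have huniv : U ∪ V = univ := by
    rw [Set.eq_univ_iff_forall]
    intro z
    by_cases hz : z ∈ U
    · exact Or.inl hz
    · exact Or.inr (hUV hz)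
  have hsum := measure_union_add_inter U hVo.measurableSet (μ := μ)
  rw [huniv, measure_univ] at hsum
  have h1 : (1 : ENNReal) + μ (U ∩ V) ≤ 1 := by
    rw [hsum]
    exact (add_le_add (h.measure_le c' hcC) (h'.measure_le c hcC')).trans (ENNReal.add_halves 1).le
  have h0 : μ (U ∩ V) = 0 := by
    by_contra hne0
    exact absurd h1 (not_le.2 (ENNReal.lt_add_right ENNReal.one_ne_top hne0))
  have hempty : U ∩ V = ∅ := ((hUo.inter hVo).measure_eq_zero_iff μ).1 h0
  have := (isPreconnected_univ (α := X)) U V hUo hVo huniv.ge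
    ⟨c', trivial, mem_connectedComponentIn hcC⟩ ⟨c, trivial, mem_connectedComponentIn hcC'⟩
  rw [hempty, Set.inter_empty] at this
  exact Set.not_nonempty_empty this

/-- The components of the `E n` that contain median continua are nested, because median continua
always meet. Their intersection is a continuum by compactness, and each of its complementary
components is exhausted by increasing complementary components of the `C n`, so the bound passes to
the limit. -/
theorem exists_isMedianContinuum_iInter [μ.IsOpenPosMeasure] [CompactSpace X] [T2Space X]
    {E : ℕ → Set X}
    (hE : Antitone E) (hcl : ∀ n, IsClosed (E n))
    (hmed : ∀ n, ∃ C ⊆ E n, IsMedianContinuum μ C) :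
    ∃ C ⊆ ⋂ n, E n, IsMedianContinuum μ C := by
  choose K hKE hK using hmed
  choose x hx using fun n => (hK n).isConnected.nonempty
  set C : ℕ → Set X := fun n => connectedComponentIn (E n) (x n) with hCdef
  have hKC : ∀ n, K n ⊆ C n := fun n =>
    (hK n).isConnected.isPreconnected.subset_connectedComponentIn (hx n) (hKE n)
  have hCcl : ∀ n, IsClosed (C n) := fun n => (hcl n).connectedComponentIn
  have hCm : ∀ n, IsMedianContinuum μ (C n) := fun n =>
    (hK n).superset (hKC n) (hCcl n) isPreconnected_connectedComponentIn
  have hCE : ∀ n, C n ⊆ E n := fun n => connectedComponentIn_subset _ _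
  have hanti : Antitone C := by
    refine antitone_nat_of_succ_le fun n => ?_
    obtain ⟨y, hy, hy'⟩ := (hCm (n + 1)).inter_nonempty (hCm n)
    have : C n = connectedComponentIn (E n) y := connectedComponentIn_eq hy'
    rw [this]
    exact isPreconnected_connectedComponentIn.subset_connectedComponentIn hy
      ((hCE _).trans (hE n.le_succ))
  refine ⟨⋂ n, C n, Set.iInter_mono hCE, isClosed_iInter hCcl, ⟨?_, ?_⟩, ?_⟩
  · exact IsCompact.nonempty_iInter_of_directed_nonempty_isCompact_isClosed C hanti.directed_ge
      (fun n => (hCm n).isConnected.nonempty) (fun n => (hCcl n).isCompact) hCcl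
  · exact IsPreconnected.iInter_antitone hanti hCcl fun n => isPreconnected_connectedComponentIn
  intro a ha
  set V : X → ℕ → Set X := fun b n => connectedComponentIn (C n)ᶜ b with hV
  have hVo : ∀ b n, IsOpen (V b n) := fun b n => (hCcl n).isOpen_compl.connectedComponentIn
  have hVmono : ∀ b, Monotone (V b) := fun b n m hnm =>
    connectedComponentIn_mono b (Set.compl_subset_compl.2 (hanti hnm))
  have hsub : connectedComponentIn (⋂ n, C n)ᶜ a ⊆ ⋃ n, V a n := by
    -- The increasing unions `⋃ n, V b n` are open and either equal or disjoint, so a connected set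
    -- meeting the one of `a` stays in it.
    have hcover : connectedComponentIn (⋂ n, C n)ᶜ a ⊆
        (⋃ n, V a n) ∪ ⋃ b ∈ (⋃ n, V a n)ᶜ, ⋃ n, V b n := by
      intro b hb
      by_cases hba : b ∈ ⋃ n, V a n
      · exact Or.inl hba
      · have := connectedComponentIn_subset _ _ hb
        simp only [Set.mem_compl_iff, Set.mem_iInter, not_forall] at this
        obtain ⟨n, hn⟩ := this
        exact Or.inr (Set.mem_biUnion hba (Set.mem_iUnion.2 ⟨n, mem_connectedComponentIn hn⟩))
    refine (isPreconnected_connectedComponentIn).subset_left_of_subset_union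
      (isOpen_iUnion fun n => hVo a n)
      (isOpen_biUnion fun b _ => isOpen_iUnion fun n => hVo b n) ?_ hcover ?_
    · rw [Set.disjoint_left]
      intro z hz hz'
      simp only [Set.mem_iUnion] at hz hz'
      obtain ⟨n, hn⟩ := hz
      obtain ⟨b, hb, m, hm⟩ := hz'
      apply hb
      have hn' := hVmono a (le_max_left n m) hn
      have hm' := hVmono b (le_max_right n m) hm
      refine Set.mem_iUnion.2 ⟨max n m, ?_⟩
      simp only [hV] at hn' hm' ⊢
      rw [connectedComponentIn_eq hn', ← connectedComponentIn_eq hm']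
      refine mem_connectedComponentIn ?_
      by_contra hbC
      rw [connectedComponentIn_eq_empty hbC] at hm'
      exact hm'
    · simp only [Set.mem_iInter, not_forall] at ha
      obtain ⟨n, hn⟩ := ha
      refine ⟨a, mem_connectedComponentIn ?_, Set.mem_iUnion.2 ⟨n, mem_connectedComponentIn hn⟩⟩
      simp only [Set.mem_compl_iff, Set.mem_iInter, not_forall]
      exact ⟨n, hn⟩
  refine (measure_mono hsub).trans ?_
  rw [(hVmono a).measure_iUnion]
  refine iSup_le fun n => ?_
  by_cases han : a ∈ C n
  · simp only [hV]
    rw [connectedComponentIn_eq_empty (by simpa using han)]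
    simp
  · exact (hCm n).measure_le a han

end

/-- A space in which any two closed connected sets covering it have connected intersection. -/
def IsUnicoherent (X : Type*) [TopologicalSpace X] : Prop :=
  ∀ A B : Set X, IsClosed A → IsClosed B → IsPreconnected A → IsPreconnected B → A ∪ B = univ →
    IsPreconnected (A ∩ B)

/-- A complementary component `U` of a component `C` of `A` has its frontier in a component `C'` of
`B`; a complementary component of `C'` of measure larger than one half lies strictly inside `U`. -/
theorem IsUnicoherent.exists_component_of_big_component [BorelSpace X]
    [LocallyConnectedSpace X] [PreconnectedSpace X] [IsProbabilityMeasure μ] (hX : IsUnicoherent X)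
    {A B : Set X} (hA : IsClosed A) (hB : IsClosed B) (hAB : A ∪ B = univ)
    (hfA : {C | ∃ x ∈ A, C = connectedComponentIn A x}.Finite)
    (hfB : {C | ∃ x ∈ B, C = connectedComponentIn B x}.Finite)
    {x a : X} (hx : x ∈ A) (ha : a ∉ connectedComponentIn A x)
    (hbig : 1 / 2 < μ (connectedComponentIn (connectedComponentIn A x)ᶜ a)) :
    ∃ y ∈ B, ∀ b,
      1 / 2 < μ (connectedComponentIn (connectedComponentIn B y)ᶜ b) →
      connectedComponentIn (connectedComponentIn B y)ᶜ b ⊂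
        connectedComponentIn (connectedComponentIn A x)ᶜ a := by
  set C := connectedComponentIn A x with hC
  set U := connectedComponentIn Cᶜ a with hU
  have hCcl : IsClosed C := hA.connectedComponentIn
  have hxC : x ∈ C := mem_connectedComponentIn hx
  have haU : a ∈ U := mem_connectedComponentIn ha
  have hUC : U ⊆ Cᶜ := connectedComponentIn_subset _ _
  have hUo : IsOpen U := hCcl.isOpen_compl.connectedComponentIn
  -- The frontier is the intersection of the closure and the complement of `U`, two closed connected
  -- sets covering the space.
  have hfr : IsPreconnected (frontier U) := by
    rw [hUo.frontier_eq, Set.sdiff_eq]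
    refine hX _ _ isClosed_closure hUo.isClosed_compl
      isPreconnected_connectedComponentIn.closure
      (isPreconnected_compl_connectedComponentIn_compl hCcl
        ⟨⟨x, hxC⟩, isPreconnected_connectedComponentIn⟩ a) ?_
    rw [Set.eq_univ_iff_forall]
    intro z
    by_cases hz : z ∈ U
    · exact Or.inl (subset_closure hz)
    · exact Or.inr hz
  have hfrC : frontier U ⊆ C := by
    intro z hz
    by_contra hzC
    have hzU : z ∉ U := by rw [hUo.frontier_eq] at hz; exact hz.2
    refine hzU ((isPreconnected_connectedComponentIn.subset_closure (Set.subset_insert z U)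
      (Set.insert_subset hz.1 subset_closure)).subset_connectedComponentIn
        (Set.mem_insert_of_mem _ haU) (Set.insert_subset hzC hUC) (Set.mem_insert _ _))
  -- Finiteness makes the union of the components meeting `U` closed, so it contains `z`. A
  -- component of `A` through `z` would be `C`, which misses `U`; hence one of `B` contains `z`.
  have hnext : ∀ z ∈ frontier U, z ∈ B ∧ (connectedComponentIn B z ∩ U).Nonempty := by
    intro z hz
    set 𝒜 := {K | (∃ w ∈ A, K = connectedComponentIn A w) ∧ (K ∩ U).Nonempty}
    set ℬ := {K | (∃ w ∈ B, K = connectedComponentIn B w) ∧ (K ∩ U).Nonempty}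
    have hA' : 𝒜.Finite := hfA.subset fun K hK => hK.1
    have hB' : ℬ.Finite := hfB.subset fun K hK => hK.1
    have hcov : U ⊆ (⋃ K ∈ 𝒜, K) ∪ ⋃ K ∈ ℬ, K := by
      intro w hw
      rcases (hAB.ge (mem_univ w) : w ∈ A ∪ B) with h | h
      · exact Or.inl (Set.mem_biUnion (x := connectedComponentIn A w)
          ⟨⟨w, h, rfl⟩, w, mem_connectedComponentIn h, hw⟩ (mem_connectedComponentIn h))
      · exact Or.inr (Set.mem_biUnion (x := connectedComponentIn B w)
          ⟨⟨w, h, rfl⟩, w, mem_connectedComponentIn h, hw⟩ (mem_connectedComponentIn h))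
    have hclosed : IsClosed ((⋃ K ∈ 𝒜, K) ∪ ⋃ K ∈ ℬ, K) := by
      refine (hA'.isClosed_biUnion ?_).union (hB'.isClosed_biUnion ?_)
      · rintro K ⟨⟨w, -, rfl⟩, -⟩
        exact hA.connectedComponentIn
      · rintro K ⟨⟨w, -, rfl⟩, -⟩
        exact hB.connectedComponentIn
    rcases closure_minimal hcov hclosed hz.1 with h | h
    · exfalso
      simp only [Set.mem_iUnion] at h
      obtain ⟨K, ⟨⟨w, -, rfl⟩, u, huK, huU⟩, hzK⟩ := h
      have : connectedComponentIn A w = C := by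
        rw [connectedComponentIn_eq hzK, ← connectedComponentIn_eq (hfrC hz)]
      exact hUC huU (this ▸ huK)
    · simp only [Set.mem_iUnion] at h
      obtain ⟨K, ⟨⟨w, -, rfl⟩, hne⟩, hzK⟩ := h
      refine ⟨connectedComponentIn_subset _ _ hzK, ?_⟩
      rwa [← connectedComponentIn_eq hzK]
  obtain ⟨y, hy⟩ : (frontier U).Nonempty := by
    rw [nonempty_frontier_iff]
    exact ⟨⟨a, haU⟩, fun h => hUC (h ▸ mem_univ x : x ∈ U) hxC⟩
  obtain ⟨hyB, u, huC, huU⟩ := hnext y hy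
  refine ⟨y, hyB, fun b hb => ?_⟩
  have hfrB : frontier U ⊆ connectedComponentIn B y :=
    hfr.subset_connectedComponentIn hy fun z hz => (hnext z hz).1
  have hsub : connectedComponentIn (connectedComponentIn B y)ᶜ b ⊆ (connectedComponentIn B y)ᶜ :=
    connectedComponentIn_subset _ _
  -- The large component avoids the frontier of `U`, so it is inside or outside `U`; two disjoint
  -- sets cannot both exceed 1/2. The inclusion is strict because the component of `B` itself meets
  -- `U`.
  rcases (isPreconnected_connectedComponentIn
    (F := (connectedComponentIn B y)ᶜ) (x := b)).subset_or_disjoint_of_disjoint_frontier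
      (u := U) (Set.disjoint_left.2 fun z hz hz' => hsub hz (hfrB hz')) with h | h
  · exact ⟨h, fun h' => hsub (h' huU) huC⟩
  · exact absurd h (not_disjoint_of_half_lt_measure hUo.measurableSet hb hbig)

/-- Otherwise every component of `A` or `B` has a complementary component larger than 1/2. Among
these finitely many, a minimal one would contain a strictly smaller one by the preceding lemma. -/
theorem IsUnicoherent.exists_median_component_of_finite [BorelSpace X]
    [LocallyConnectedSpace X] [PreconnectedSpace X] [IsProbabilityMeasure μ] (hX : IsUnicoherent X)
    {A B : Set X} (hA : IsClosed A) (hB : IsClosed B) (hAB : A ∪ B = univ)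
    (hfA : {C | ∃ x ∈ A, C = connectedComponentIn A x}.Finite)
    (hfB : {C | ∃ x ∈ B, C = connectedComponentIn B x}.Finite) :
    ∃ C, (C ⊆ A ∨ C ⊆ B) ∧ IsMedianContinuum μ C := by
  by_contra! hno
  have hbigA : ∀ x ∈ A, ∃ a ∉ connectedComponentIn A x,
      1 / 2 < μ (connectedComponentIn (connectedComponentIn A x)ᶜ a) := by
    intro x hx
    by_contra! h
    exact hno _ (Or.inl (connectedComponentIn_subset A x)) ⟨hA.connectedComponentIn,
      ⟨⟨x, mem_connectedComponentIn hx⟩, isPreconnected_connectedComponentIn⟩, h⟩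
  have hbigB : ∀ x ∈ B, ∃ a ∉ connectedComponentIn B x,
      1 / 2 < μ (connectedComponentIn (connectedComponentIn B x)ᶜ a) := by
    intro x hx
    by_contra! h
    exact hno _ (Or.inr (connectedComponentIn_subset B x)) ⟨hB.connectedComponentIn,
      ⟨⟨x, mem_connectedComponentIn hx⟩, isPreconnected_connectedComponentIn⟩, h⟩
  set 𝒦 := {C | ∃ x ∈ A, C = connectedComponentIn A x} ∪ {C | ∃ x ∈ B, C = connectedComponentIn B x}
    with h𝒦
  have hbig : ∀ C ∈ 𝒦, ∃ a ∉ C, 1 / 2 < μ (connectedComponentIn Cᶜ a) := by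
    rintro C (⟨x, hx, rfl⟩ | ⟨x, hx, rfl⟩)
    · exact hbigA x hx
    · exact hbigB x hx
  have : Nonempty X := nonempty_of_isProbabilityMeasure μ
  choose! a ha hlt using hbig
  have hne : 𝒦.Nonempty := by
    have hAne : univ.Nonempty → (A ∪ B).Nonempty := fun h => hAB ▸ h
    obtain ⟨x, hx | hx⟩ := hAne univ_nonempty
    · exact ⟨_, Or.inl ⟨x, hx, rfl⟩⟩
    · exact ⟨_, Or.inr ⟨x, hx, rfl⟩⟩
  obtain ⟨C, hC, hmin⟩ := (hfA.union hfB).exists_minimalFor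
    (fun C => connectedComponentIn Cᶜ (a C)) 𝒦 hne
  have hBA : B ∪ A = univ := by rw [Set.union_comm, hAB]
  rcases hC with ⟨x, hx, rfl⟩ | ⟨x, hx, rfl⟩
  · obtain ⟨y, hy, h⟩ := hX.exists_component_of_big_component hA hB hAB hfA hfB hx
      (ha _ (Or.inl ⟨x, hx, rfl⟩)) (hlt _ (Or.inl ⟨x, hx, rfl⟩))
    have hyK : connectedComponentIn B y ∈ 𝒦 := Or.inr ⟨y, hy, rfl⟩
    have hss := h _ (hlt _ hyK)
    exact hss.2 (hmin hyK hss.1)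
  · obtain ⟨y, hy, h⟩ := hX.exists_component_of_big_component hB hA hBA hfB hfA hx
      (ha _ (Or.inr ⟨x, hx, rfl⟩)) (hlt _ (Or.inr ⟨x, hx, rfl⟩))
    have hyK : connectedComponentIn A y ∈ 𝒦 := Or.inl ⟨y, hy, rfl⟩
    have hss := h _ (hlt _ hyK)
    exact hss.2 (hmin hyK hss.1)

end MedianContinua

/-! ### Median continua inside fibres -/

section MedianFibres

open Set

theorem IsPreconnected.subsingleton_of_volume_eq_zero {s : Set ℝ} (hs : IsPreconnected s)
    (h0 : volume s = 0) : s.Subsingleton := by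
  have key : ∀ x ∈ s, ∀ y ∈ s, ¬ x < y := by
    intro x hx y hy hxy
    have h := measure_mono_null (hs.ordConnected.out hx hy) h0
    rw [Real.volume_Icc, ENNReal.ofReal_eq_zero] at h
    linarith
  exact fun x hx y hy => le_antisymm (not_lt.1 (key y hy x hx)) (not_lt.1 (key x hx y hy))

/-- A compact set in a locally connected metric space has arbitrarily small closed thickenings with
finitely many components. -/
theorem IsCompact.exists_thickening_finite_components {X : Type*} [MetricSpace X]
    [LocallyConnectedSpace X] {A : Set X} (hA : IsCompact A) {r : ℝ} (hr : 0 < r) :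
    ∃ A', IsClosed A' ∧ A ⊆ A' ∧ A' ⊆ Metric.cthickening r A ∧
      {C | ∃ x ∈ A', C = connectedComponentIn A' x}.Finite := by
  set V : X → Set X := fun x => connectedComponentIn (Metric.ball x r) x
  have hxV : ∀ x, x ∈ V x := fun x => mem_connectedComponentIn (Metric.mem_ball_self hr)
  obtain ⟨t, htA, ht⟩ := hA.elim_nhds_subcover V fun x _ =>
    (Metric.isOpen_ball.connectedComponentIn).mem_nhds (hxV x)
  refine ⟨⋃ x ∈ t, closure (V x), t.finite_toSet.isClosed_biUnion fun x _ => isClosed_closure,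
    ht.trans (Set.iUnion₂_mono fun x _ => subset_closure), ?_, ?_⟩
  · refine Set.iUnion₂_subset fun x hx => ?_
    refine closure_minimal ?_ Metric.isClosed_cthickening
    refine (connectedComponentIn_subset _ _).trans (fun z hz => ?_)
    exact Metric.mem_cthickening_of_dist_le z x r A (htA x hx) (Metric.mem_ball.1 hz).le
  -- Each component contains a whole `closure (V x)`, so it is named by one of the finitely many
  -- centres.
  · refine (t.finite_toSet.image fun x =>
      connectedComponentIn (⋃ x ∈ t, closure (V x)) x).subset ?_
    rintro C ⟨y, hy, rfl⟩
    obtain ⟨x, hx, hyx⟩ := Set.mem_iUnion₂.1 hy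
    refine ⟨x, hx, connectedComponentIn_eq ?_⟩
    exact (isPreconnected_connectedComponentIn.closure).subset_connectedComponentIn
      (subset_closure (hxV x)) (Set.subset_biUnion_of_mem (u := fun x => closure (V x)) hx) hyx

theorem Metric.iInter_cthickening_one_div {X : Type*} [MetricSpace X] {A : Set X}
    (hA : IsClosed A) : ⋂ n : ℕ, Metric.cthickening (1 / ((n : ℝ) + 1)) A = A := by
  refine Set.Subset.antisymm (fun x hx => ?_) (Set.subset_iInter fun n =>
    Metric.self_subset_cthickening A)
  rw [← hA.closure_eq, Metric.closure_eq_iInter_cthickening]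
  simp only [Set.mem_iInter] at hx ⊢
  intro δ hδ
  obtain ⟨n, hn⟩ := exists_nat_one_div_lt hδ
  exact Metric.cthickening_mono hn.le A (hx n)

theorem antitone_one_div_nat : Antitone fun n : ℕ => 1 / ((n : ℝ) + 1) := fun n m hnm =>
  one_div_le_one_div_of_le (by positivity) (by exact_mod_cast Nat.succ_le_succ hnm)

variable {X : Type*} [MetricSpace X] [CompactSpace X] [PreconnectedSpace X]
  [LocallyConnectedSpace X] [MeasurableSpace X] [BorelSpace X] {μ : Measure X}
  [IsProbabilityMeasure μ] [μ.IsOpenPosMeasure]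

/-- Thickenings with finitely many components reduce to the finite case. Either the thickenings of
`A` succeed at every scale, or they fail at some scale and hence at all finer ones, where those of
`B` succeed; nested intersection finishes. -/
theorem IsUnicoherent.exists_median_of_union (hX : IsUnicoherent X) {A B : Set X} (hA : IsClosed A)
    (hB : IsClosed B) (hAB : A ∪ B = univ) :
    (∃ C ⊆ A, IsMedianContinuum μ C) ∨ ∃ C ⊆ B, IsMedianContinuum μ C := by
  set EA : ℕ → Set X := fun n => Metric.cthickening (1 / ((n : ℝ) + 1)) A
  set EB : ℕ → Set X := fun n => Metric.cthickening (1 / ((n : ℝ) + 1)) B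
  have hEA : Antitone EA := fun n m h => Metric.cthickening_mono (antitone_one_div_nat h) A
  have hEB : Antitone EB := fun n m h => Metric.cthickening_mono (antitone_one_div_nat h) B
  have hstep : ∀ n, (∃ C ⊆ EA n, IsMedianContinuum μ C) ∨ ∃ C ⊆ EB n, IsMedianContinuum μ C := by
    intro n
    have hn : 0 < 1 / ((n : ℝ) + 1) := by positivity
    obtain ⟨A', hA', hAA', hA'E, hfA⟩ := hA.isCompact.exists_thickening_finite_components hn
    obtain ⟨B', hB', hBB', hB'E, hfB⟩ := hB.isCompact.exists_thickening_finite_components hn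
    obtain ⟨C, hC | hC, hm⟩ := hX.exists_median_component_of_finite (μ := μ) hA' hB'
      (Set.univ_subset_iff.1 (hAB.ge.trans (Set.union_subset_union hAA' hBB'))) hfA hfB
    · exact Or.inl ⟨C, hC.trans hA'E, hm⟩
    · exact Or.inr ⟨C, hC.trans hB'E, hm⟩
  by_cases h : ∀ n, ∃ C ⊆ EA n, IsMedianContinuum μ C
  · left
    have := exists_isMedianContinuum_iInter hEA (fun n => Metric.isClosed_cthickening) h
    rwa [Metric.iInter_cthickening_one_div hA] at this
  · right
    obtain ⟨n₀, hn₀⟩ := not_forall.1 h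
    have h' : ∀ n, ∃ C ⊆ EB n, IsMedianContinuum μ C := by
      intro n
      rcases hstep (max n n₀) with ⟨C, hC, hm⟩ | ⟨C, hC, hm⟩
      · exact absurd ⟨C, hC.trans (hEA (le_max_right _ _)), hm⟩ hn₀
      · exact ⟨C, hC.trans (hEB (le_max_left _ _)), hm⟩
    have := exists_isMedianContinuum_iInter hEB (fun n => Metric.isClosed_cthickening) h'
    rwa [Metric.iInter_cthickening_one_div hB] at this

/-- If a continuous map into a metric space is nearly constant on some median continua, then it
is constant on one of them. -/
theorem exists_median_eq_const_of_forall {Y : Type*} [MetricSpace Y] [CompleteSpace Y]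
    {F : X → Y} (hF : Continuous F)
    (h : ∀ ε > 0, ∃ C, IsMedianContinuum μ C ∧ ∀ x ∈ C, ∀ y ∈ C, dist (F x) (F y) ≤ ε) :
    ∃ c, ∃ C ⊆ F ⁻¹' {c}, IsMedianContinuum μ C := by
  choose K hK hosc using fun n : ℕ => h (1 / ((n : ℝ) + 1)) (by positivity)
  choose x hx using fun n => (hK n).isConnected.nonempty
  -- `K n` and `K m` share a point, so their values differ by at most the sum of the two
  -- oscillations.
  have hdist : ∀ n m, ∀ y ∈ K m, dist (F (x n)) (F y) ≤ 1 / ((n : ℝ) + 1) + 1 / ((m : ℝ) + 1) := by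
    intro n m y hy
    obtain ⟨z, hzn, hzm⟩ := (hK n).inter_nonempty (hK m)
    exact (dist_triangle _ (F z) _).trans (add_le_add (hosc n _ (hx n) _ hzn) (hosc m _ hzm _ hy))
  have htend : Filter.Tendsto (fun n : ℕ => 1 / ((n : ℝ) + 1) + 1 / ((n : ℝ) + 1)) Filter.atTop
      (𝓝 0) := by
    simpa using (tendsto_one_div_add_atTop_nhds_zero_nat (𝕜 := ℝ)).add
      (tendsto_one_div_add_atTop_nhds_zero_nat (𝕜 := ℝ))
  have hcau : CauchySeq fun n => F (x n) := by
    refine cauchySeq_of_le_tendsto_0 _ (fun n m N hn hm => ?_) htend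
    exact (hdist n m _ (hx m)).trans
      (add_le_add (antitone_one_div_nat hn) (antitone_one_div_nat hm))
  obtain ⟨c, hc⟩ := cauchySeq_tendsto_of_complete hcau
  refine ⟨c, ?_⟩
  have hcK : ∀ m, ∀ y ∈ K m, dist (F y) c ≤ 1 / ((m : ℝ) + 1) := by
    intro m y hy
    have h1 : Filter.Tendsto (fun n => dist (F (x n)) (F y)) Filter.atTop (𝓝 (dist c (F y))) :=
      hc.dist tendsto_const_nhds
    have h2 : Filter.Tendsto (fun n : ℕ => 1 / ((n : ℝ) + 1) + 1 / ((m : ℝ) + 1)) Filter.atTop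
        (𝓝 (0 + 1 / ((m : ℝ) + 1))) :=
      (tendsto_one_div_add_atTop_nhds_zero_nat (𝕜 := ℝ)).add tendsto_const_nhds
    have := le_of_tendsto_of_tendsto' h1 h2 fun n => hdist n m y hy
    rwa [dist_comm, zero_add] at this
  obtain ⟨C, hC, hm⟩ := exists_isMedianContinuum_iInter (μ := μ)
    (E := fun n : ℕ => F ⁻¹' Metric.closedBall c (1 / ((n : ℝ) + 1)))
    (fun n m hnm => Set.preimage_mono (Metric.closedBall_subset_closedBall
      (antitone_one_div_nat hnm)))
    (fun n => Metric.isClosed_closedBall.preimage hF) (fun n => ⟨K n, hcK n, hK n⟩)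
  refine ⟨C, fun y hy => ?_, hm⟩
  have hy' := hC hy
  simp only [Set.mem_iInter, Set.mem_preimage, Metric.mem_closedBall] at hy'
  exact dist_le_zero.1 (ge_of_tendsto' (tendsto_one_div_add_atTop_nhds_zero_nat (𝕜 := ℝ)) hy')

/-- Supplies the positions of grid lines: one point of `S` is taken in each interval (nε, (n+1)ε),
so a longer gap would contain one. -/
theorem exists_mem_of_dense_slices {S : Set ℝ} (hS : Dense S) {ε : ℝ} (hε : 0 < ε) (M : ℝ) :
    ∃ G : Finset ℝ, G.Nonempty ∧ ↑G ⊆ S ∧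
      ∀ J : Set ℝ, IsPreconnected J → J ⊆ Icc (-M) M → Disjoint J (G : Set ℝ) →
        ∀ x ∈ J, ∀ y ∈ J, dist x y ≤ 2 * ε := by
  have hex : ∀ n : ℤ, ∃ a ∈ S, a ∈ Ioo (n * ε) ((n + 1) * ε) := by
    intro n
    obtain ⟨a, ha, haS⟩ := hS.exists_mem_open isOpen_Ioo
      (nonempty_Ioo.2 (by nlinarith : (n : ℝ) * ε < (n + 1) * ε))
    exact ⟨a, ha, haS⟩
  choose a haS ha using hex
  -- Inserting 0 keeps the index set nonempty even when `M` is negative.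
  refine ⟨(insert 0 (Finset.Icc ⌊-M / ε⌋ (⌊M / ε⌋ + 1))).image a, by simp, ?_, ?_⟩
  · intro z hz
    simp only [Finset.coe_image, Set.mem_image] at hz
    obtain ⟨n, -, rfl⟩ := hz
    exact haS n
  · intro J hJ hJM hd
    have key : ∀ x ∈ J, ∀ y ∈ J, y - x ≤ 2 * ε := by
      intro x hx y hy
      by_contra! hlt
      -- The first grid cell beyond `x`; it ends at or before x + 2ε, hence before `y`.
      set n := ⌊x / ε⌋ + 1 with hn
      have h1 : x < n * ε := by
        have := Int.lt_floor_add_one (x / ε)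
        rw [div_lt_iff₀ hε] at this
        simpa [hn] using this
      have h2 : (n : ℝ) * ε ≤ x + ε := by
        have := Int.floor_le (x / ε)
        rw [le_div_iff₀ hε] at this
        push_cast [hn]
        linarith
      have han := ha n
      have haJ : a n ∈ J := hJ.ordConnected.out hx hy
        ⟨by linarith [han.1], by nlinarith [han.2]⟩
      refine Set.disjoint_left.1 hd haJ ?_
      simp only [Finset.coe_image, Set.mem_image]
      refine ⟨n, ?_, rfl⟩
      simp only [Finset.coe_insert, Set.mem_insert_iff, Finset.mem_coe, Finset.mem_Icc]
      right
      constructor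
      · have : ⌊-M / ε⌋ ≤ ⌊x / ε⌋ := Int.floor_le_floor (by gcongr; exact (hJM hx).1)
        omega
      · have : ⌊x / ε⌋ ≤ ⌊M / ε⌋ := Int.floor_le_floor (by gcongr; exact (hJM hx).2)
        omega
    intro x hx y hy
    rw [Real.dist_eq, abs_le]
    exact ⟨by linarith [key x hx y hy], by linarith [key y hy x hx]⟩

/-- If a pair of functions has an image of measure zero, then it is constant on some median
continuum. -/
theorem IsUnicoherent.exists_median_eq_const_prod (hX : IsUnicoherent X) {Φ : X → ℝ × ℝ}
    (hΦ : Continuous Φ) (h0 : volume (range Φ) = 0) :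
    ∃ c, ∃ C ⊆ Φ ⁻¹' {c}, IsMedianContinuum μ C := by
  refine exists_median_eq_const_of_forall hΦ fun ε hε => ?_
  set K := range Φ with hK
  have hKc : IsCompact K := isCompact_range hΦ
  obtain ⟨M, hM⟩ := hKc.isBounded.subset_closedBall 0
  have hM1 : ∀ x, (Φ x).1 ∈ Icc (-M) M := fun x => by
    have := hM (mem_range_self x)
    rw [mem_closedBall_zero_iff, Prod.norm_def, max_le_iff] at this
    exact abs_le.1 this.1
  have hM2 : ∀ x, (Φ x).2 ∈ Icc (-M) M := fun x => by
    have := hM (mem_range_self x)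
    rw [mem_closedBall_zero_iff, Prod.norm_def, max_le_iff] at this
    exact abs_le.1 this.2
  -- By Fubini almost every line parallel to an axis meets `K` in a null set; grid lines are chosen
  -- among these.
  have hS1 : Dense {a : ℝ | volume {b : ℝ | (a, b) ∈ K} = 0} := by
    rw [Measure.volume_eq_prod, Measure.measure_prod_null hKc.measurableSet] at h0
    exact Measure.dense_of_ae h0
  have hS2 : Dense {b : ℝ | volume {a : ℝ | (a, b) ∈ K} = 0} := by
    have h0' : (volume.prod volume) (Prod.swap ⁻¹' K : Set (ℝ × ℝ)) = 0 := by
      rw [(Measure.measurePreserving_swap (μ := (volume : Measure ℝ))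
        (ν := (volume : Measure ℝ))).measure_preimage hKc.measurableSet.nullMeasurableSet]
      exact h0
    rw [Measure.measure_prod_null (measurable_swap hKc.measurableSet)] at h0'
    exact Measure.dense_of_ae h0'
  obtain ⟨G₁, hne₁, hG₁, hosc₁⟩ := exists_mem_of_dense_slices hS1 (half_pos hε) M
  obtain ⟨G₂, -, hG₂, hosc₂⟩ := exists_mem_of_dense_slices hS2 (half_pos hε) M
  set L : Set (ℝ × ℝ) := Prod.fst ⁻¹' (G₁ : Set ℝ) ∪ Prod.snd ⁻¹' (G₂ : Set ℝ) with hL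
  have hLc : IsClosed L := (G₁.finite_toSet.isClosed.preimage continuous_fst).union
    (G₂.finite_toSet.isClosed.preimage continuous_snd)
  have hLne : L.Nonempty := by
    obtain ⟨a, ha⟩ := hne₁
    exact ⟨(a, 0), Or.inl ha⟩
  have hd : Continuous fun x => Metric.infDist (Φ x) L := (Metric.continuous_infDist_pt L).comp hΦ
  -- Either every neighbourhood of the grid contains the image of a median continuum, and then so
  -- does the grid itself, or some median continuum avoids the grid.
  by_cases hcase : ∀ n : ℕ, ∃ C ⊆ {x | Metric.infDist (Φ x) L ≤ 1 / ((n : ℝ) + 1)},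
      IsMedianContinuum μ C
  · obtain ⟨C, hC, hm⟩ := exists_isMedianContinuum_iInter (μ := μ)
      (E := fun n : ℕ => {x | Metric.infDist (Φ x) L ≤ 1 / ((n : ℝ) + 1)})
      (fun n m hnm x hx => le_trans hx (antitone_one_div_nat hnm))
      (fun n => isClosed_le hd continuous_const) hcase
    have hCL : ∀ x ∈ C, Φ x ∈ L := by
      intro x hx
      rw [hLc.mem_iff_infDist_zero hLne]
      have hx' := hC hx
      simp only [Set.mem_iInter, Set.mem_ofPred_eq] at hx'
      exact le_antisymm (ge_of_tendsto' (tendsto_one_div_add_atTop_nhds_zero_nat (𝕜 := ℝ)) hx')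
        Metric.infDist_nonneg
    refine ⟨C, hm, ?_⟩
    have hconn := hm.isConnected.isPreconnected
    -- Over the grid, the first coordinate lies in the finite set `G₁` or in one of finitely many
    -- null slices. Its image is a null interval, hence a point.
    have h1 : ((fun x => (Φ x).1) '' C).Subsingleton := by
      refine (hconn.image _ (continuous_fst.comp hΦ).continuousOn).subsingleton_of_volume_eq_zero ?_
      refine measure_mono_null (t := (G₁ : Set ℝ) ∪ ⋃ b ∈ G₂, {a : ℝ | (a, b) ∈ K}) ?_ ?_
      · rintro _ ⟨x, hx, rfl⟩
        rcases hCL x hx with h | h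
        · exact Or.inl h
        · exact Or.inr (Set.mem_biUnion (t := fun b => {a : ℝ | (a, b) ∈ K}) h ⟨x, rfl⟩)
      · refine measure_union_null (G₁.finite_toSet.measure_zero _) ?_
        exact (measure_biUnion_null_iff G₂.countable_toSet).2 fun b hb => hG₂ hb
    have h2 : ((fun x => (Φ x).2) '' C).Subsingleton := by
      refine (hconn.image _ (continuous_snd.comp hΦ).continuousOn).subsingleton_of_volume_eq_zero ?_
      refine measure_mono_null (t := (⋃ a ∈ G₁, {b : ℝ | (a, b) ∈ K}) ∪ (G₂ : Set ℝ)) ?_ ?_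
      · rintro _ ⟨x, hx, rfl⟩
        rcases hCL x hx with h | h
        · exact Or.inl (Set.mem_biUnion (t := fun a => {b : ℝ | (a, b) ∈ K}) h ⟨x, rfl⟩)
        · exact Or.inr h
      · refine measure_union_null ?_ (G₂.finite_toSet.measure_zero _)
        exact (measure_biUnion_null_iff G₁.countable_toSet).2 fun a ha => hG₁ ha
    intro x hx y hy
    rw [Prod.ext (h1 ⟨x, hx, rfl⟩ ⟨y, hy, rfl⟩) (h2 ⟨x, hx, rfl⟩ ⟨y, hy, rfl⟩), dist_self]
    exact hε.le
  · obtain ⟨n, hn⟩ := not_forall.1 hcase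
    have hpos : 0 < 1 / ((n : ℝ) + 1) := by positivity
    obtain ⟨C, hC, hm⟩ := (hX.exists_median_of_union (μ := μ)
      (isClosed_le hd continuous_const : IsClosed {x | Metric.infDist (Φ x) L ≤ 1 / ((n : ℝ) + 1)})
      (isClosed_le continuous_const hd : IsClosed {x | 1 / ((n : ℝ) + 1) ≤ Metric.infDist (Φ x) L})
      (Set.eq_univ_of_forall fun x => le_total (Metric.infDist (Φ x) L) _)).resolve_left hn
    have hCL : ∀ x ∈ C, Φ x ∉ L := by
      intro x hx hxL
      have : 1 / ((n : ℝ) + 1) ≤ Metric.infDist (Φ x) L := hC hx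
      rw [Metric.infDist_zero_of_mem hxL] at this
      exact absurd this (not_le.2 hpos)
    have hconn := hm.isConnected.isPreconnected
    refine ⟨C, hm, fun x hx y hy => ?_⟩
    -- Off the grid, each coordinate is confined to a gap between lines.
    have h1 := hosc₁ _ (hconn.image _ (continuous_fst.comp hΦ).continuousOn)
      (by rintro _ ⟨x, -, rfl⟩; exact hM1 x)
      (Set.disjoint_left.2 (by rintro _ ⟨x, hx, rfl⟩ h; exact hCL x hx (Or.inl h)))
      _ ⟨x, hx, rfl⟩ _ ⟨y, hy, rfl⟩
    have h2 := hosc₂ _ (hconn.image _ (continuous_snd.comp hΦ).continuousOn)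
      (by rintro _ ⟨x, -, rfl⟩; exact hM2 x)
      (Set.disjoint_left.2 (by rintro _ ⟨x, hx, rfl⟩ h; exact hCL x hx (Or.inr h)))
      _ ⟨x, hx, rfl⟩ _ ⟨y, hy, rfl⟩
    rw [Prod.dist_eq]
    refine max_le (h1.trans ?_) (h2.trans ?_) <;> linarith

theorem IsUnicoherent.exists_median_eq_const (hX : IsUnicoherent X) {F : X → ℝ}
    (hF : Continuous F) : ∃ c, ∃ C ⊆ F ⁻¹' {c}, IsMedianContinuum μ C := by
  obtain ⟨c, C, hC, hm⟩ := hX.exists_median_eq_const_prod (μ := μ)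
    (Φ := fun x => (F x, (0 : ℝ))) (by fun_prop) (by
      refine measure_mono_null (t := univ ×ˢ {0}) ?_ ?_
      · rintro _ ⟨x, rfl⟩
        exact ⟨trivial, rfl⟩
      · rw [Measure.volume_eq_prod, Measure.prod_prod]
        simp)
  exact ⟨c.1, C, fun x hx => congrArg Prod.fst (hC hx), hm⟩

end MedianFibres

/-! ### Unicoherence from lifting circle-valued maps -/

section Unicoherence

open Set

/-- The values lie in the countable set 2πℤ. Applied to differences, it says that two arguments of
one circle-valued map differ by a constant. -/
theorem IsPreconnected.eqOn_const_of_circle_exp_eq_one {X : Type*} [TopologicalSpace X] {s : Set X}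
    (hs : IsPreconnected s) {g : X → ℝ} (hg : ContinuousOn g s)
    (h : ∀ x ∈ s, Circle.exp (g x) = 1) : ∀ x ∈ s, ∀ y ∈ s, g x = g y := by
  have hsub : (g '' s).Subsingleton := by
    refine (hs.image g hg).subsingleton_of_volume_eq_zero (Set.Countable.measure_zero ?_ _)
    refine (countable_range fun n : ℤ => (n : ℝ) * (2 * Real.pi)).mono ?_
    rintro _ ⟨x, hx, rfl⟩
    obtain ⟨n, hn⟩ := Circle.exp_eq_one.1 (h x hx)
    exact ⟨n, hn.symm⟩
  exact fun x hx y hy => hsub ⟨x, hx, rfl⟩ ⟨y, hy, rfl⟩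

/-- A normal space on which maps to the circle have continuous arguments is unicoherent. -/
theorem isUnicoherent_of_circle_lift {X : Type*} [TopologicalSpace X] [NormalSpace X]
    (hlift : ∀ f : X → Circle, Continuous f →
      ∃ θ : X → ℝ, Continuous θ ∧ ∀ x, Circle.exp (θ x) = f x) : IsUnicoherent X := by
  intro A B hA hB hAc hBc hAB
  rw [isPreconnected_closed_iff]
  intro t t' ht ht' hcov ⟨p, hp, hpt⟩ ⟨q, hq, hqt⟩
  by_contra hne
  have hd : Disjoint (A ∩ B ∩ t) (A ∩ B ∩ t') := by
    rw [Set.disjoint_left]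
    rintro z ⟨hz, hzt⟩ ⟨-, hzt'⟩
    exact hne ⟨z, hz, hzt, hzt'⟩
  obtain ⟨u, hu0, hu1, -⟩ := exists_continuous_zero_one_of_isClosed
    ((hA.inter hB).inter ht) ((hA.inter hB).inter ht') hd
  classical
  -- `A` is sent to the upper semicircle and `B` to the lower one; the definitions agree on `A ∩ B`,
  -- where `u` is 0 or 1.
  set f : X → Circle := fun x =>
    if x ∈ A then Circle.exp (Real.pi * u x) else Circle.exp (-(Real.pi * u x)) with hf
  have hfA : ∀ x ∈ A, f x = Circle.exp (Real.pi * u x) := fun x hx => if_pos hx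
  have hfB : ∀ x ∈ B, f x = Circle.exp (-(Real.pi * u x)) := by
    intro x hx
    by_cases hxA : x ∈ A
    · rw [hfA x hxA]
      rcases hcov ⟨hxA, hx⟩ with h | h
      · have : u x = 0 := hu0 ⟨⟨hxA, hx⟩, h⟩
        simp [this]
      · have : u x = 1 := hu1 ⟨⟨hxA, hx⟩, h⟩
        rw [this, Circle.exp_eq_exp]
        exact ⟨1, by push_cast; ring⟩
    · exact if_neg hxA
  have hfc : Continuous f := by
    rw [← continuousOn_univ, ← hAB]
    refine ContinuousOn.union_of_isClosed ?_ ?_ hA hB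
    · exact ContinuousOn.congr (f := fun x => Circle.exp (Real.pi * u x))
        (by fun_prop) hfA
    · exact ContinuousOn.congr (f := fun x => Circle.exp (-(Real.pi * u x)))
        (by fun_prop) hfB
  obtain ⟨θ, hθ, hθf⟩ := hlift f hfc
  -- From `p` to `q` the argument `θ` would increase by π along `A` and decrease by π along `B`.
  have h1 := hAc.eqOn_const_of_circle_exp_eq_one (g := fun x => θ x - Real.pi * u x)
    (by fun_prop) (fun x hx => by rw [Circle.exp_sub, hθf, hfA x hx, div_self']) p hp.1 q hq.1
  have h2 := hBc.eqOn_const_of_circle_exp_eq_one (g := fun x => θ x - -(Real.pi * u x))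
    (by fun_prop) (fun x hx => by rw [Circle.exp_sub, hθf, hfB x hx, div_self']) p hp.2 q hq.2
  have hup : u p = 0 := hu0 ⟨hp, hpt⟩
  have huq : u q = 1 := hu1 ⟨hq, hqt⟩
  simp only [hup, huq] at h1 h2
  linarith [Real.pi_pos]

end Unicoherence

/-! ### Unicoherence of the sphere -/

namespace MedianSphere

open Set

instance : ConnectedSpace S2 := by
  refine isConnected_iff_connectedSpace.1 (isConnected_sphere ?_ _ zero_le_one)
  rw [← Module.finrank_eq_rank, finrank_euclideanSpace_fin]
  norm_num

instance : LocallyConnectedSpace S2 :=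
  ChartedSpace.locallyConnectedSpace (EuclideanSpace ℝ (Fin 2)) S2

/-- Stereographic projection turns the punctured sphere into a plane, over which maps lift through
the covering `Circle.exp`. -/
theorem exists_circle_lift_compl_singleton (f : S2 → Circle) (hf : Continuous f) (v : S2) :
    ∃ θ : S2 → ℝ, ContinuousOn θ {v}ᶜ ∧ ∀ x ≠ v, Circle.exp (θ x) = f x := by
  have hv : ‖(v : E3)‖ = 1 := norm_eq_of_mem_sphere v
  set σ := stereographic hv with hσ
  have hsrc : σ.source = {v}ᶜ := stereographic_source hv
  have htgt : σ.target = univ := stereographic_target hv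
  have hc : Continuous fun w => f (σ.symm w) := by
    refine hf.comp ?_
    have := σ.continuousOn_symm
    rwa [htgt, continuousOn_univ] at this
  have he₀ := Circle.exp_arg (f (σ.symm 0))
  obtain ⟨F, ⟨-, hF⟩, -⟩ := Circle.isCoveringMap_exp.existsUnique_continuousMap_lifts
    ⟨fun w => f (σ.symm w), hc⟩ 0 _ he₀
  refine ⟨fun x => F (σ x), ?_, fun x hx => ?_⟩
  · rw [← hsrc]
    exact F.continuous.comp_continuousOn σ.continuousOn
  · have := congrFun hF (σ x)
    simp only [Function.comp_apply, ContinuousMap.coe_mk] at this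
    rw [this, σ.left_inv (by rw [hsrc]; exact hx)]

theorem isPreconnected_compl_antipodes (v : S2) : IsPreconnected ({v}ᶜ ∩ {-v}ᶜ : Set S2) := by
  have hv : ‖(v : E3)‖ = 1 := norm_eq_of_mem_sphere v
  set σ := stereographic hv with hσ
  have hsrc : σ.source = {v}ᶜ := stereographic_source hv
  have htgt : σ.target = univ := stereographic_target hv
  have h0 : σ (-v) = 0 := stereographic_apply_neg v
  have hc : Continuous σ.symm := by
    have := σ.continuousOn_symm
    rwa [htgt, continuousOn_univ] at this
  have hneg : -v ∈ σ.source := by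
    rw [hsrc]
    exact (ne_neg_of_mem_unit_sphere ℝ v).symm
  have hW : IsPreconnected ({0}ᶜ : Set (ℝ ∙ (v : E3))ᗮ) := by
    refine (isConnected_compl_singleton_of_one_lt_rank ?_ 0).isPreconnected
    have : Fact (Module.finrank ℝ E3 = 2 + 1) := ⟨finrank_euclideanSpace_fin⟩
    rw [← Module.finrank_eq_rank, Submodule.finrank_orthogonal_span_singleton (n := 2)
      (ne_zero_of_mem_unit_sphere v)]
    norm_num
  convert hW.image σ.symm hc.continuousOn using 1
  ext x
  simp only [mem_inter_iff, mem_compl_iff, mem_singleton_iff, mem_image]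
  constructor
  · rintro ⟨h1, h2⟩
    have hx : x ∈ σ.source := by rw [hsrc]; exact h1
    exact ⟨σ x, fun h => h2 (σ.injOn hx hneg (h.trans h0.symm)), σ.left_inv hx⟩
  · rintro ⟨w, hw, rfl⟩
    have hwt : w ∈ σ.target := by rw [htgt]; trivial
    refine ⟨?_, fun h => hw ?_⟩
    · have := σ.map_target hwt
      rwa [hsrc] at this
    · rw [← σ.right_inv hwt, h, h0]

/-- The arguments found off `v` and off `-v` differ by a constant on the connected overlap, so they
glue after a shift by it. -/
theorem exists_circle_lift (f : S2 → Circle) (hf : Continuous f) :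
    ∃ θ : S2 → ℝ, Continuous θ ∧ ∀ x, Circle.exp (θ x) = f x := by
  obtain ⟨v⟩ : Nonempty S2 := inferInstance
  obtain ⟨θ₁, hc₁, h₁⟩ := exists_circle_lift_compl_singleton f hf v
  obtain ⟨θ₂, hc₂, h₂⟩ := exists_circle_lift_compl_singleton f hf (-v)
  have hvv : v ≠ -v := ne_neg_of_mem_unit_sphere ℝ v
  have hconst := (isPreconnected_compl_antipodes v).eqOn_const_of_circle_exp_eq_one
    (g := fun x => θ₁ x - θ₂ x)
    ((hc₁.mono inter_subset_left).sub (hc₂.mono inter_subset_right))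
    (fun x hx => by rw [Circle.exp_sub, h₁ x hx.1, h₂ x hx.2, div_self'])
  obtain ⟨k, hk1, hk⟩ : ∃ k, Circle.exp k = 1 ∧ ∀ x, x ≠ v → x ≠ -v → θ₁ x = θ₂ x + k := by
    by_cases hne : ({v}ᶜ ∩ {-v}ᶜ : Set S2).Nonempty
    · obtain ⟨y, hy⟩ := hne
      refine ⟨θ₁ y - θ₂ y, by rw [Circle.exp_sub, h₁ y hy.1, h₂ y hy.2, div_self'],
        fun x hx hx' => ?_⟩
      have := hconst x ⟨hx, hx'⟩ y hy
      linarith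
    · exact ⟨0, by simp, fun x hx hx' => absurd ⟨x, hx, hx'⟩ hne⟩
  classical
  set θ : S2 → ℝ := fun x => if x = v then θ₂ x + k else θ₁ x with hθ
  have hθ₁ : EqOn θ θ₁ {v}ᶜ := fun x hx => if_neg hx
  have hθ₂ : EqOn θ (fun x => θ₂ x + k) {-v}ᶜ := by
    intro x hx
    by_cases hxv : x = v
    · exact if_pos hxv
    · exact (if_neg hxv).trans (hk x hxv hx)
  refine ⟨θ, ?_, fun x => ?_⟩
  · rw [← continuousOn_univ]
    have : (univ : Set S2) = {v}ᶜ ∪ {-v}ᶜ := by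
      refine (Set.eq_univ_of_forall fun x => ?_).symm
      by_cases hxv : x = v
      · exact Or.inr (by rw [hxv]; exact hvv)
      · exact Or.inl hxv
    rw [this]
    refine ContinuousOn.union_of_isOpen (hc₁.congr hθ₁) ?_ isOpen_compl_singleton
      isOpen_compl_singleton
    exact ContinuousOn.congr (hc₂.add continuousOn_const) hθ₂
  · by_cases hxv : x = v
    · have hx : x ≠ -v := by rw [hxv]; exact hvv
      rw [hθ₂ hx, Circle.exp_add, hk1, mul_one, h₂ x hx]
    · rw [hθ₁ hxv, h₁ x hxv]

theorem isUnicoherent_S2 : IsUnicoherent S2 := isUnicoherent_of_circle_lift exists_circle_lift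

/-! ### The normalized area -/

instance : IsProbabilityMeasure area := by
  constructor
  rw [area, Measure.smul_apply, Measure.toSphere_apply_univ, finrank_euclideanSpace_fin,
    EuclideanSpace.volume_ball_fin_three, smul_eq_mul]
  rw [← ENNReal.ofReal_natCast, ← ENNReal.ofReal_pow zero_le_one,
    ← ENNReal.ofReal_mul (by positivity), ← ENNReal.ofReal_mul (by positivity),
    ← ENNReal.ofReal_mul (by positivity), ← ENNReal.ofReal_one]
  congr 1
  have := Real.pi_ne_zero
  push_cast
  field_simp

instance : area.IsOpenPosMeasure := by
  refine Measure.isOpenPosMeasure_smul _ ?_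
  rw [Ne, ENNReal.ofReal_eq_zero, not_le]
  positivity

end MedianSphere

namespace MedianSphere

open Set
open scoped Pointwise

/-! ### The Reeb graph and median continua -/

/-- The component through `p` of the level set of `F`. -/
def levelComponent (F : C(S2, ℝ)) (p : S2) : Set S2 := connectedComponentIn (F ⁻¹' {F p}) p

theorem mem_levelComponent (F : C(S2, ℝ)) (p : S2) : p ∈ levelComponent F p :=
  mem_connectedComponentIn rfl

theorem toReeb_eq_iff {F : C(S2, ℝ)} {p q : S2} :
    toReeb F p = toReeb F q ↔ q ∈ levelComponent F p :=
  Quotient.eq (r := levelSetoid F)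

theorem isClosed_levelComponent (F : C(S2, ℝ)) (p : S2) : IsClosed (levelComponent F p) :=
  (isClosed_singleton.preimage F.continuous).connectedComponentIn

theorem isQuotientMap_toReeb (F : C(S2, ℝ)) : IsQuotientMap (toReeb F) := isQuotientMap_quot_mk

theorem preimage_toReeb_singleton (F : C(S2, ℝ)) (p : S2) :
    toReeb F ⁻¹' {toReeb F p} = levelComponent F p := by
  ext q
  rw [← toReeb_eq_iff]
  exact eq_comm

/-- Fibres of `toReeb` are connected, so the components of the complement of a level component are
saturated. Being open, they map to disjoint open sets covering the punctured Reeb graph, whose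
components they therefore are. -/
theorem preimage_connectedComponentIn_reeb {F : C(S2, ℝ)} {p q : S2}
    (hq : q ∉ levelComponent F p) :
    toReeb F ⁻¹' connectedComponentIn {toReeb F p}ᶜ (toReeb F q) =
      connectedComponentIn (levelComponent F p)ᶜ q := by
  set C := levelComponent F p with hC
  have hpre : toReeb F ⁻¹' {toReeb F p}ᶜ = Cᶜ := by
    rw [preimage_compl, preimage_toReeb_singleton]
  have hsat : ∀ b z z', z ∈ connectedComponentIn Cᶜ b → toReeb F z = toReeb F z' →
      z' ∈ connectedComponentIn Cᶜ b := by
    intro b z z' hz hzz'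
    have hzC : z ∈ Cᶜ := connectedComponentIn_subset _ _ hz
    have hsub : levelComponent F z ⊆ Cᶜ := by
      intro y hy hyC
      apply hzC
      rw [hC, ← toReeb_eq_iff, toReeb_eq_iff.2 hyC, ← toReeb_eq_iff.2 hy]
    rw [connectedComponentIn_eq hz]
    exact isPreconnected_connectedComponentIn.subset_connectedComponentIn
      (mem_levelComponent F z) hsub (toReeb_eq_iff.1 hzz')
  have hWo : ∀ b, IsOpen (connectedComponentIn Cᶜ b) := fun b =>
    (isClosed_levelComponent F p).isOpen_compl.connectedComponentIn
  have hopen : ∀ b, IsOpen (toReeb F '' connectedComponentIn Cᶜ b) := by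
    intro b
    rw [← (isQuotientMap_toReeb F).isOpen_preimage]
    convert hWo b using 1
    refine Subset.antisymm ?_ (subset_preimage_image _ _)
    rintro z' ⟨z, hz, hzz'⟩
    exact hsat b z z' hz hzz'
  refine Subset.antisymm ?_ ?_
  · have hsub : connectedComponentIn {toReeb F p}ᶜ (toReeb F q) ⊆
        toReeb F '' connectedComponentIn Cᶜ q := by
      refine isPreconnected_connectedComponentIn.subset_left_of_subset_union (hopen q)
        (isOpen_biUnion (s := {b | b ∉ connectedComponentIn Cᶜ q}) fun b _ => hopen b) ?_ ?_ ?_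
      · rw [Set.disjoint_left]
        rintro _ ⟨z, hz, rfl⟩ hz'
        obtain ⟨b, hb, w, hw, hwz⟩ := Set.mem_iUnion₂.1 hz'
        have hwq := hsat q z w hz hwz.symm
        apply hb
        rw [connectedComponentIn_eq hwq, ← connectedComponentIn_eq hw]
        refine mem_connectedComponentIn ?_
        by_contra hbC
        rw [connectedComponentIn_eq_empty hbC] at hw
        exact hw
      · intro m hm
        obtain ⟨b, rfl⟩ := (isQuotientMap_toReeb F).surjective m
        by_cases hb : b ∈ connectedComponentIn Cᶜ q
        · exact Or.inl ⟨b, hb, rfl⟩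
        · refine Or.inr (Set.mem_biUnion (x := b) hb ⟨b, mem_connectedComponentIn ?_, rfl⟩)
          rw [← hpre]
          exact connectedComponentIn_subset {toReeb F p}ᶜ _ hm
      · refine ⟨toReeb F q, mem_connectedComponentIn ?_, q, mem_connectedComponentIn hq, rfl⟩
        exact fun h => hq (toReeb_eq_iff.1 (mem_singleton_iff.1 h).symm)
    intro z' hz'
    obtain ⟨z, hz, hzz'⟩ := hsub hz'
    exact hsat q z z' hz hzz'
  · rw [← image_subset_iff]
    refine (isPreconnected_connectedComponentIn.image _
      (isQuotientMap_toReeb F).continuous.continuousOn).subset_connectedComponentIn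
        ⟨q, mem_connectedComponentIn hq, rfl⟩ ?_
    rw [image_subset_iff, hpre]
    exact connectedComponentIn_subset _ _

theorem isMedian_iff {F : C(S2, ℝ)} {p : S2} :
    IsMedian F (toReeb F p) ↔ IsMedianContinuum area (levelComponent F p) := by
  have key : ∀ q ∉ levelComponent F p,
      reebMeasure F (connectedComponentIn {toReeb F p}ᶜ (toReeb F q)) =
        area (connectedComponentIn (levelComponent F p)ᶜ q) := by
    intro q hq
    have hopen : IsOpen (connectedComponentIn {toReeb F p}ᶜ (toReeb F q)) := by
      rw [← (isQuotientMap_toReeb F).isOpen_preimage, preimage_connectedComponentIn_reeb hq]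
      exact (isClosed_levelComponent F p).isOpen_compl.connectedComponentIn
    rw [reebMeasure, Measure.map_apply (isQuotientMap_toReeb F).continuous.measurable
      hopen.measurableSet, preimage_connectedComponentIn_reeb hq]
  constructor
  · intro h
    refine ⟨isClosed_levelComponent F p, ⟨⟨p, mem_levelComponent F p⟩,
      isPreconnected_connectedComponentIn⟩, fun q hq => ?_⟩
    rw [← key q hq]
    exact h _ fun hqp => hq (toReeb_eq_iff.1 hqp.symm)
  · intro h a ha
    obtain ⟨q, rfl⟩ := (isQuotientMap_toReeb F).surjective a
    have hq : q ∉ levelComponent F p := fun hq => ha (toReeb_eq_iff.2 hq).symm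
    rw [key q hq]
    exact h.measure_le q hq

theorem isMedianContinuum_levelComponent {F : C(S2, ℝ)} {C : Set S2} {c : ℝ}
    (hC : C ⊆ F ⁻¹' {c}) (hm : IsMedianContinuum area C) {p : S2} (hp : p ∈ C) :
    IsMedianContinuum area (levelComponent F p) := by
  refine hm.superset (hm.isConnected.isPreconnected.subset_connectedComponentIn hp ?_)
    (isClosed_levelComponent F p) isPreconnected_connectedComponentIn
  rwa [show F p = c from hC hp]

/-- A median continuum on which `F` is constant enlarges to a level component. Any two median level
components meet, hence coincide. -/
theorem existsUnique_isMedian (F : C(S2, ℝ)) : ∃! m : ReebGraph F, IsMedian F m := by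
  obtain ⟨c, C, hC, hm⟩ := isUnicoherent_S2.exists_median_eq_const (μ := area) F.continuous
  obtain ⟨p, hp⟩ := hm.isConnected.nonempty
  have hmp := isMedianContinuum_levelComponent hC hm hp
  refine ⟨toReeb F p, isMedian_iff.2 hmp, fun m hm' => ?_⟩
  obtain ⟨q, rfl⟩ := (isQuotientMap_toReeb F).surjective m
  obtain ⟨z, hzq, hzp⟩ := (isMedian_iff.1 hm').inter_nonempty hmp
  exact (toReeb_eq_iff.2 hzq).trans (toReeb_eq_iff.2 hzp).symm

/-! ### The median value -/

theorem exists_medianValue (F : C(S2, ℝ)) :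
    ∃ c, ∃ C ⊆ F ⁻¹' {c}, IsMedianContinuum area C :=
  isUnicoherent_S2.exists_median_eq_const F.continuous

/-- The value of a continuous function on the median of its Reeb graph. -/
noncomputable def medianValue (F : C(S2, ℝ)) : ℝ := (exists_medianValue F).choose

theorem exists_eq_medianValue_of_median (F : C(S2, ℝ)) {C : Set S2}
    (hm : IsMedianContinuum area C) : ∃ x ∈ C, F x = medianValue F := by
  obtain ⟨K, hK, hKm⟩ := (exists_medianValue F).choose_spec
  obtain ⟨x, hx, hx'⟩ := hm.inter_nonempty hKm
  exact ⟨x, hx, hK hx'⟩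

theorem medianValue_eq {F : C(S2, ℝ)} {C : Set S2} {c : ℝ} (hm : IsMedianContinuum area C)
    (hC : ∀ x ∈ C, F x = c) : medianValue F = c := by
  obtain ⟨x, hx, h⟩ := exists_eq_medianValue_of_median F hm
  rw [← h, hC x hx]

/-- The median continua of `F` and `G` intersect. Comparing medians thus reduces to comparing values
at one point. -/
theorem exists_apply_eq_medianValue (F G : C(S2, ℝ)) :
    ∃ x, F x = medianValue F ∧ G x = medianValue G := by
  obtain ⟨K, hK, hKm⟩ := (exists_medianValue F).choose_spec
  obtain ⟨x, hx, h⟩ := exists_eq_medianValue_of_median G hKm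
  exact ⟨x, hK hx, h⟩

theorem medianValue_mono : Monotone medianValue := by
  intro F G h
  obtain ⟨x, hF, hG⟩ := exists_apply_eq_medianValue F G
  rw [← hF, ← hG]
  exact h x

theorem abs_medianValue_sub_le (F G : C(S2, ℝ)) :
    |medianValue F - medianValue G| ≤ ‖F - G‖ := by
  obtain ⟨x, hF, hG⟩ := exists_apply_eq_medianValue F G
  rw [← hF, ← hG]
  exact (F - G).norm_coe_le_norm x

theorem continuous_medianValue : Continuous medianValue := by
  refine (LipschitzWith.of_dist_le_mul (K := 1) fun F G => ?_).continuous
  rw [NNReal.coe_one, one_mul, Real.dist_eq, dist_eq_norm]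
  exact abs_medianValue_sub_le F G

theorem medianValue_eq_of_isMedian {F : C(S2, ℝ)} {p : S2} (h : IsMedian F (toReeb F p)) :
    medianValue F = F p :=
  medianValue_eq (isMedian_iff.1 h) fun _ hx =>
    connectedComponentIn_subset (F ⁻¹' {F p}) p hx

theorem isMedianExtension_medianValue : IsMedianExtension medianValue :=
  ⟨continuous_medianValue, fun _ _ _ h => medianValue_eq_of_isMedian h⟩

theorem medianValue_linear_of_volume_range {F G : C(S2, ℝ)}
    (h : volume (range fun p => (F p, G p)) = 0) (a b : ℝ) :
    medianValue (a • F + b • G) = a * medianValue F + b * medianValue G := by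
  obtain ⟨c, C, hC, hm⟩ := isUnicoherent_S2.exists_median_eq_const_prod (μ := area)
    (Φ := fun p => (F p, G p)) (by fun_prop) h
  have hF : ∀ x ∈ C, F x = c.1 := fun x hx => congrArg Prod.fst (hC hx)
  have hG : ∀ x ∈ C, G x = c.2 := fun x hx => congrArg Prod.snd (hC hx)
  rw [medianValue_eq hm hF, medianValue_eq hm hG]
  refine medianValue_eq hm fun x hx => ?_
  simp [hF x hx, hG x hx]

/-! ### Great circles -/

theorem area_neg (s : Set S2) (hs : MeasurableSet s) : area (-s) = area s := by
  have hs' : MeasurableSet (-s) := by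
    rw [← Set.image_neg_eq_neg, Set.image_neg_eq_neg]
    exact continuous_neg.measurable hs
  rw [area, Measure.smul_apply, Measure.smul_apply, Measure.toSphere_apply' _ hs,
    Measure.toSphere_apply' _ hs']
  congr 2
  -- `toSphere` measures a set by the volume of its cone, and Lebesgue measure is invariant under
  -- negation.
  rw [← Measure.measure_neg volume (Ioo (0 : ℝ) 1 • (Subtype.val '' s))]
  congr 1
  ext x
  simp only [Set.mem_smul, Set.mem_neg, mem_image]
  constructor
  · rintro ⟨r, hr, _, ⟨y, hy, rfl⟩, rfl⟩
    exact ⟨r, hr, _, ⟨-y, hy, rfl⟩, by simp⟩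
  · rintro ⟨r, hr, _, ⟨y, hy, rfl⟩, h⟩
    exact ⟨r, hr, _, ⟨-y, by simpa using hy, rfl⟩, by simpa using congrArg Neg.neg h⟩

/-- The great circle on which the `i`-th coordinate vanishes. -/
def greatCircle (i : Fin 3) : Set S2 := {p | coord i p = 0}

theorem isConnected_greatCircle (i : Fin 3) : IsConnected (greatCircle i) := by
  have hS : IsConnected (Metric.sphere (0 : EuclideanSpace ℝ (Fin 2)) 1) := by
    refine isConnected_sphere ?_ _ zero_le_one
    rw [← Module.finrank_eq_rank, finrank_euclideanSpace_fin]
    norm_num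
  have hS' := isConnected_iff_connectedSpace.1 hS
  set g : EuclideanSpace ℝ (Fin 2) → E3 := fun w => WithLp.toLp 2 (i.insertNth 0 w.ofLp)
  have hg : Continuous g := by
    refine (PiLp.continuous_toLp 2 _).comp ?_
    exact continuous_const.finInsertNth i (PiLp.continuous_ofLp 2 _)
  have hnorm : ∀ w, ‖g w‖ = ‖w‖ := by
    intro w
    rw [EuclideanSpace.norm_eq, EuclideanSpace.norm_eq, Fin.sum_univ_succAbove _ i]
    simp [g]
  have hmem : ∀ w : Metric.sphere (0 : EuclideanSpace ℝ (Fin 2)) 1,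
      g w ∈ Metric.sphere (0 : E3) 1 := by
    intro w
    rw [mem_sphere_zero_iff_norm, hnorm]
    exact norm_eq_of_mem_sphere w
  have := isConnected_range (f := fun w : Metric.sphere (0 : EuclideanSpace ℝ (Fin 2)) 1 =>
    (⟨g w, hmem w⟩ : S2)) (by fun_prop)
  convert this using 1
  ext p
  constructor
  · intro hp
    have hgp : g (WithLp.toLp 2 (i.removeNth (p : E3).ofLp)) = p := by
      refine (WithLp.ofLp_injective 2) ?_
      simp only [g]
      rw [← Fin.insertNth_self_removeNth i (p : E3).ofLp]
      congr 1
      · exact (show (p : E3) i = 0 from hp).symm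
      · simp
    refine ⟨⟨WithLp.toLp 2 (i.removeNth (p : E3).ofLp), ?_⟩, Subtype.ext hgp⟩
    rw [mem_sphere_zero_iff_norm, ← hnorm, hgp]
    exact norm_eq_of_mem_sphere p
  · rintro ⟨w, rfl⟩
    simp [greatCircle, coord, g]

/-- Each complementary component lies in one of two disjoint open hemispheres, which have equal area
by the antipodal symmetry. -/
theorem isMedianContinuum_greatCircle (i : Fin 3) : IsMedianContinuum area (greatCircle i) := by
  refine ⟨isClosed_singleton.preimage (coord i).continuous, isConnected_greatCircle i,
    fun a ha => ?_⟩
  set P : Set S2 := {p | 0 < coord i p}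
  have hPo : IsOpen P := isOpen_lt continuous_const (coord i).continuous
  have hNP : -P = {p | coord i p < 0} := by
    ext p
    simp [P, coord]
  have hN : area (-P) = area P := area_neg P hPo.measurableSet
  have hhalf : area P ≤ 1 / 2 := by
    by_contra! h
    refine not_disjoint_of_half_lt_measure (μ := area) hPo.measurableSet
      (h.trans_eq hN.symm) h ?_
    rw [hNP, Set.disjoint_left]
    exact fun x hx hx' => lt_asymm (a := coord i x) hx hx'
  set W := connectedComponentIn (greatCircle i)ᶜ a with hW
  have hWs : W ⊆ (greatCircle i)ᶜ := connectedComponentIn_subset _ _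
  rcases (isPreconnected_connectedComponentIn : IsPreconnected W).subset_or_subset hPo
    (isOpen_lt (coord i).continuous continuous_const : IsOpen {p | coord i p < 0})
    (Set.disjoint_left.2 fun x hx hx' => lt_asymm (a := (0 : ℝ)) hx hx')
    (fun x hx => (lt_or_gt_of_ne (hWs hx)).symm) with h | h
  · exact (measure_mono h).trans hhalf
  · rw [← hNP] at h
    exact (measure_mono h).trans (hN.le.trans hhalf)

theorem medianValue_coord_sq (i : Fin 3) : medianValue (coord i ^ 2) = 0 :=
  medianValue_eq (isMedianContinuum_greatCircle i) fun x hx => by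
    have : coord i x = 0 := hx
    simp [this]

theorem medianValue_coord_sq_add :
    medianValue (coord 0 ^ 2 + coord 1 ^ 2) = 1 := by
  refine medianValue_eq (isMedianContinuum_greatCircle 2) fun x hx => ?_
  have h2 : (x : E3) 2 = 0 := hx
  have h1 : ‖(x : E3)‖ ^ 2 = 1 := by simp
  rw [EuclideanSpace.norm_sq_eq, Fin.sum_univ_three, h2] at h1
  simpa [coord] using h1

end MedianSphere

namespace MedianSphere

open Set

/-! ### Functions with vanishing Poisson bracket -/

theorem radialExtension_apply (F : C(S2, ℝ)) {x : E3} (hx : x ≠ 0) :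
    radialExtension F x = F ⟨‖x‖⁻¹ • x, by simp [norm_smul, hx]⟩ := dif_pos hx

theorem radialExtension_coe (F : C(S2, ℝ)) (p : S2) : radialExtension F p = F p := by
  rw [radialExtension_apply F (ne_zero_of_mem_unit_sphere p)]
  congr 1
  exact Subtype.ext (by simp)

theorem IsSmooth.contDiffAt_radialExtension {F : C(S2, ℝ)} (hF : IsSmooth F) {x : E3}
    (hx : x ≠ 0) : ContDiffAt ℝ ∞ (radialExtension F) x := by
  have : Fact (Module.finrank ℝ E3 = 2 + 1) := ⟨finrank_euclideanSpace_fin⟩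
  set U : TopologicalSpace.Opens E3 := ⟨{0}ᶜ, isOpen_compl_singleton⟩ with hU
  have hne : ∀ y : U, (y : E3) ≠ 0 := fun y => y.2
  have h1 : ContMDiff 𝓘(ℝ, E3) 𝓘(ℝ, E3) ∞ (fun y : U => ‖(y : E3)‖⁻¹ • (y : E3)) := by
    intro y
    refine (contMDiffAt_subtype_iff (f := fun z : E3 => ‖z‖⁻¹ • z)).2 ?_
    exact (((contDiffAt_norm ℝ (hne y)).inv (norm_ne_zero_iff.2 (hne y))).smul
      contDiffAt_id).contMDiffAt
  have h2 : ∀ y : U, ‖(y : E3)‖⁻¹ • (y : E3) ∈ Metric.sphere (0 : E3) 1 := fun y => by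
    simp [norm_smul, hne y]
  have h3 := ContMDiff.comp (I' := 𝓡 2) hF (h1.codRestrict_sphere h2)
  have h4 := (contMDiffAt_subtype_iff (f := radialExtension F) (x := (⟨x, hx⟩ : U))
    (I := 𝓘(ℝ, E3)) (I' := 𝓘(ℝ, ℝ)) (n := ∞)).1 (by
      convert h3 ⟨x, hx⟩ using 1
      funext y
      exact radialExtension_apply F (hne y))
  exact contMDiffAt_iff_contDiffAt.1 h4

/-- Spherical coordinates. -/
noncomputable def sphericalCoord (w : ℝ × ℝ) : E3 :=
  !₂[Real.cos w.1 * Real.cos w.2, Real.cos w.1 * Real.sin w.2, Real.sin w.1]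

theorem norm_sphericalCoord (w : ℝ × ℝ) : ‖sphericalCoord w‖ = 1 := by
  rw [← sq_eq_sq₀ (norm_nonneg _) zero_le_one, EuclideanSpace.norm_sq_eq, Fin.sum_univ_three]
  simp only [sphericalCoord, Real.norm_eq_abs, sq_abs, Matrix.cons_val_zero, Matrix.cons_val_one,
    Matrix.cons_val]
  linear_combination Real.cos w.1 ^ 2 * Real.sin_sq_add_cos_sq w.2 + Real.sin_sq_add_cos_sq w.1

theorem exists_sphericalCoord_eq (p : S2) : ∃ w, sphericalCoord w = p := by
  have h1 : ‖(p : E3)‖ ^ 2 = 1 := by simp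
  rw [EuclideanSpace.norm_sq_eq, Fin.sum_univ_three] at h1
  simp only [Real.norm_eq_abs, sq_abs] at h1
  set z : ℂ := ⟨(p : E3) 0, (p : E3) 1⟩ with hz
  have hcos : Real.cos (Real.arcsin ((p : E3) 2)) = ‖z‖ := by
    rw [Real.cos_arcsin, Complex.norm_def, Complex.normSq_apply]
    congr 1
    simp only [hz]
    linarith
  have hsin : Real.sin (Real.arcsin ((p : E3) 2)) = (p : E3) 2 :=
    Real.sin_arcsin (by nlinarith [sq_nonneg ((p : E3) 0), sq_nonneg ((p : E3) 1)])
      (by nlinarith [sq_nonneg ((p : E3) 0), sq_nonneg ((p : E3) 1)])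
  refine ⟨(Real.arcsin ((p : E3) 2), z.arg), ?_⟩
  ext i
  fin_cases i
  · simp [sphericalCoord, hcos, Complex.norm_mul_cos_arg, hz]
  · simp [sphericalCoord, hcos, Complex.norm_mul_sin_arg, hz]
  · simp [sphericalCoord, hsin]

theorem det_prod_eq (L : ℝ × ℝ →L[ℝ] ℝ × ℝ) :
    L.det = (L (1, 0)).1 * (L (0, 1)).2 - (L (0, 1)).1 * (L (1, 0)).2 := by
  rw [ContinuousLinearMap.det, ← LinearMap.det_toMatrix (Module.Basis.finTwoProd ℝ),
    Matrix.det_fin_two]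
  simp [LinearMap.toMatrix_apply]

/-- The identity det(p, g × p, w × p) = |p|² det(p, g, w) with |p| = 1; one factor 4π of the two
Hamiltonian fields cancels against `areaForm`. -/
theorem poissonBracket_eq (F G : C(S2, ℝ)) (p : S2) :
    poissonBracket F G p =
      (4 * Real.pi) * (Matrix.of ![(p : E3).ofLp, (grad F p).ofLp, (grad G p).ofLp]).det := by
  have hp : ‖(p : E3)‖ ^ 2 = 1 := by simp
  rw [EuclideanSpace.norm_sq_eq] at hp
  simp only [Fin.sum_univ_three, Real.norm_eq_abs, sq_abs] at hp
  have h4 : (4 * Real.pi)⁻¹ * (4 * Real.pi) = 1 := inv_mul_cancel₀ (by positivity)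
  simp [poissonBracket, areaForm, hamiltonianField, Matrix.det_fin_three, cross_apply,
    -mul_inv_rev]
  generalize (4 * Real.pi)⁻¹ = c at *
  generalize 4 * Real.pi = d at *
  generalize (p : E3).ofLp = x, (grad F p).ofLp = g, (grad G p).ofLp = w at *
  linear_combination (x 0 ^ 2 + x 1 ^ 2 + x 2 ^ 2) * d *
    (x 0 * g 1 * w 2 - x 0 * g 2 * w 1 - x 1 * g 0 * w 2 + x 1 * g 2 * w 0 + x 2 * g 0 * w 1
      - x 2 * g 1 * w 0) * h4 + d *
    (x 0 * g 1 * w 2 - x 0 * g 2 * w 1 - x 1 * g 0 * w 2 + x 1 * g 2 * w 0 + x 2 * g 0 * w 1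
      - x 2 * g 1 * w 0) * hp

theorem hasDerivAt_euclidean {f : ℝ → E3} {f' : E3} {t : ℝ}
    (h : ∀ i, HasDerivAt (fun s => f s i) (f' i) t) : HasDerivAt f f' t := by
  rw [hasDerivAt_iff_hasFDerivAt, ← hasFDerivWithinAt_univ, hasFDerivWithinAt_euclidean]
  intro i
  rw [hasFDerivWithinAt_univ]
  convert! (h i).hasFDerivAt using 1

theorem hasFDerivAt_sphericalCoord (w : ℝ × ℝ) : ∃ L : ℝ × ℝ →L[ℝ] E3,
    HasFDerivAt sphericalCoord L w ∧
    L (1, 0) = !₂[-Real.sin w.1 * Real.cos w.2, -Real.sin w.1 * Real.sin w.2, Real.cos w.1] ∧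
    L (0, 1) = !₂[-Real.cos w.1 * Real.sin w.2, Real.cos w.1 * Real.cos w.2, 0] := by
  have hd : Differentiable ℝ sphericalCoord := by
    rw [differentiable_euclidean]
    intro i
    fin_cases i <;> simp [sphericalCoord] <;> fun_prop
  refine ⟨fderiv ℝ sphericalCoord w, (hd w).hasFDerivAt, ?_, ?_⟩
  · have h := (hd w).hasFDerivAt.comp_hasDerivAt w.1
      ((hasDerivAt_id w.1).prodMk (hasDerivAt_const w.1 w.2))
    refine h.unique ?_
    refine hasDerivAt_euclidean fun i => ?_
    fin_cases i
    · simpa [sphericalCoord] using (Real.hasDerivAt_cos w.1).mul_const (Real.cos w.2)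
    · simpa [sphericalCoord] using (Real.hasDerivAt_cos w.1).mul_const (Real.sin w.2)
    · simpa [sphericalCoord] using Real.hasDerivAt_sin w.1
  · have h := (hd w).hasFDerivAt.comp_hasDerivAt w.2
      ((hasDerivAt_const w.2 w.1).prodMk (hasDerivAt_id w.2))
    refine h.unique ?_
    refine hasDerivAt_euclidean fun i => ?_
    fin_cases i
    · simpa [sphericalCoord] using (Real.hasDerivAt_cos w.2).const_mul (Real.cos w.1)
    · simpa [sphericalCoord] using (Real.hasDerivAt_sin w.2).const_mul (Real.cos w.1)
    · simpa [sphericalCoord] using hasDerivAt_const w.2 (Real.sin w.1)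

theorem fderiv_radialExtension_apply (F : C(S2, ℝ)) (p : S2) (v : E3) :
    fderiv ℝ (radialExtension F) p v =
      (grad F p) 0 * v 0 + (grad F p) 1 * v 1 + (grad F p) 2 * v 2 := by
  have : fderiv ℝ (radialExtension F) p v = inner ℝ (grad F p) v := by
    rw [grad, gradient, InnerProductSpace.toDual_symm_apply]
  rw [this, PiLp.inner_apply, Fin.sum_univ_three]
  simp [mul_comm]

/-- In spherical coordinates the Jacobian of (F, G) is −cos(latitude) · det(p, grad F, grad G),
which vanishes with the bracket. The easy equidimensional case of Sard's theorem then makes the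
image null. -/
theorem PoissonCommute.volume_range_eq_zero {F G : C(S2, ℝ)} (h : PoissonCommute F G) :
    volume (range fun p => (F p, G p)) = 0 := by
  obtain ⟨hF, hG, hFG⟩ := h
  have hrange : (range fun p => (F p, G p)) ⊆ (fun w : ℝ × ℝ =>
      (radialExtension F (sphericalCoord w), radialExtension G (sphericalCoord w))) '' univ := by
    rintro _ ⟨p, rfl⟩
    obtain ⟨w, hw⟩ := exists_sphericalCoord_eq p
    exact ⟨w, trivial, by simp only [hw, radialExtension_coe]⟩
  refine measure_mono_null hrange ?_
  choose L hL hL1 hL2 using hasFDerivAt_sphericalCoord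
  have hmem : ∀ w, sphericalCoord w ∈ Metric.sphere (0 : E3) 1 := fun w => by
    rw [mem_sphere_zero_iff_norm, norm_sphericalCoord]
  have hne : ∀ w, sphericalCoord w ≠ 0 := fun w =>
    ne_zero_of_mem_unit_sphere (⟨_, hmem w⟩ : S2)
  refine addHaar_image_eq_zero_of_det_fderivWithin_eq_zero volume
    (f' := fun w => ((fderiv ℝ (radialExtension F) (sphericalCoord w)).comp (L w)).prod
      ((fderiv ℝ (radialExtension G) (sphericalCoord w)).comp (L w)))
    (fun w _ => ?_) (fun w _ => ?_)
  · have h1 := ((hF.contDiffAt_radialExtension (hne w)).differentiableAt (by simp)).hasFDerivAt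
    have h2 := ((hG.contDiffAt_radialExtension (hne w)).differentiableAt (by simp)).hasFDerivAt
    exact ((h1.comp w (hL w)).prodMk (h2.comp w (hL w))).hasFDerivWithinAt
  · have h0 := hFG ⟨_, hmem w⟩
    rw [poissonBracket_eq, mul_eq_zero, or_iff_right (by positivity), Matrix.det_fin_three] at h0
    have eF := fderiv_radialExtension_apply F ⟨_, hmem w⟩
    have eG := fderiv_radialExtension_apply G ⟨_, hmem w⟩
    simp only at eF eG
    rw [det_prod_eq]
    simp only [ContinuousLinearMap.prod_apply, ContinuousLinearMap.comp_apply, hL1, hL2, eF, eG]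
    generalize grad F ⟨_, hmem w⟩ = g at *
    generalize grad G ⟨_, hmem w⟩ = k at *
    simp [sphericalCoord] at h0 ⊢
    linear_combination (-Real.cos w.1) * h0 +
      Real.cos w.1 * Real.sin w.1 * (g 0 * k 1 - g 1 * k 0) *
        (-Real.sin_sq_add_cos_sq w.2)

theorem isQuasiState_medianValue : IsQuasiState medianValue where
  positivity F hF := by
    rw [← medianValue_eq (F := 0) (c := 0) (isMedianContinuum_greatCircle 0) fun _ _ => rfl]
    exact medianValue_mono hF
  normalization := medianValue_eq (isMedianContinuum_greatCircle 0) fun _ _ => rfl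
  quasi_linearity a b _ _ h := medianValue_linear_of_volume_range h.volume_range_eq_zero a b

end MedianSphere

namespace MedianSphere

open Set

/-! ### Smooth functions on the sphere -/

theorem IsSmooth.add {F G : C(S2, ℝ)} (hF : IsSmooth F) (hG : IsSmooth G) : IsSmooth (F + G) :=
  ContMDiff.add hF hG

theorem IsSmooth.mul {F G : C(S2, ℝ)} (hF : IsSmooth F) (hG : IsSmooth G) : IsSmooth (F * G) :=
  ContMDiff.mul hF hG

theorem IsSmooth.const_smul {F : C(S2, ℝ)} (hF : IsSmooth F) (c : ℝ) : IsSmooth (c • F) :=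
  ContMDiff.mul (contMDiff_const (c := c)) hF

/-- The restriction to the sphere of a continuous function on the ambient space. -/
def restrictSphere (Q : E3 → ℝ) (hQ : Continuous Q) : C(S2, ℝ) :=
  ⟨fun p => Q p, hQ.comp continuous_subtype_val⟩

theorem isSmooth_restrictSphere {Q : E3 → ℝ} (hQ : ContDiff ℝ ∞ Q) :
    IsSmooth (restrictSphere Q hQ.continuous) := by
  have : Fact (Module.finrank ℝ E3 = 2 + 1) := ⟨finrank_euclideanSpace_fin⟩
  exact hQ.contMDiff.comp (contMDiff_coe_sphere (n := 2))

theorem isSmooth_coord (i : Fin 3) : IsSmooth (coord i) :=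
  isSmooth_restrictSphere (Q := fun x => x i) (by fun_prop)

theorem dense_isSmooth : Dense {F : C(S2, ℝ) | IsSmooth F} := by
  let A : Subalgebra ℝ C(S2, ℝ) :=
    { carrier := {F | IsSmooth F}
      mul_mem' := fun h h' => h.mul h'
      add_mem' := fun h h' => h.add h'
      algebraMap_mem' := fun c => contMDiff_const (c := c) }
  have hA : A.SeparatesPoints := by
    intro p q hpq
    by_contra! h
    apply hpq
    ext i
    exact h (coord i) ⟨coord i, isSmooth_coord i, rfl⟩
  have := ContinuousMap.subalgebra_topologicalClosure_eq_top_of_separatesPoints A hA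
  rw [dense_iff_closure_eq]
  exact congrArg (fun B : Subalgebra ℝ C(S2, ℝ) => (B : Set C(S2, ℝ))) this

theorem radialExtension_add (F G : C(S2, ℝ)) :
    radialExtension (F + G) = radialExtension F + radialExtension G := by
  funext x
  by_cases hx : x = 0
  · simp [radialExtension, hx]
  · simp [radialExtension_apply _ hx]

theorem radialExtension_const_smul (c : ℝ) (F : C(S2, ℝ)) :
    radialExtension (c • F) = c • radialExtension F := by
  funext x
  by_cases hx : x = 0
  · simp [radialExtension, hx]
  · simp [radialExtension_apply _ hx]

theorem IsSmooth.differentiableAt {F : C(S2, ℝ)} (hF : IsSmooth F) {x : E3} (hx : x ≠ 0) :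
    DifferentiableAt ℝ (radialExtension F) x :=
  (hF.contDiffAt_radialExtension hx).differentiableAt (by simp)

theorem IsSmooth.differentiableAt_fderiv {F : C(S2, ℝ)} (hF : IsSmooth F) {x : E3} (hx : x ≠ 0) :
    DifferentiableAt ℝ (fderiv ℝ (radialExtension F)) x :=
  ((hF.contDiffAt_radialExtension hx).fderiv_right (m := 1) (by norm_cast)).differentiableAt
    (by simp)

theorem IsSmooth.differentiableAt_gradient {F : C(S2, ℝ)} (hF : IsSmooth F) {x : E3}
    (hx : x ≠ 0) : DifferentiableAt ℝ (gradient (radialExtension F)) x :=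
  ((InnerProductSpace.toDual ℝ E3).symm.toContinuousLinearEquiv.differentiableAt).comp x
    (hF.differentiableAt_fderiv hx)

theorem IsSmooth.continuous_grad {F : C(S2, ℝ)} (hF : IsSmooth F) : Continuous (grad F) := by
  rw [continuous_iff_continuousAt]
  intro p
  exact (hF.differentiableAt_gradient (ne_zero_of_mem_unit_sphere p)).continuousAt.comp
    continuous_subtype_val.continuousAt

theorem grad_add {F G : C(S2, ℝ)} (hF : IsSmooth F) (hG : IsSmooth G) (p : S2) :
    grad (F + G) p = grad F p + grad G p := by
  have hp := ne_zero_of_mem_unit_sphere p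
  rw [grad, gradient, radialExtension_add, fderiv_add (hF.differentiableAt hp)
    (hG.differentiableAt hp), map_add]
  rfl

theorem grad_const_smul {F : C(S2, ℝ)} (hF : IsSmooth F) (c : ℝ) (p : S2) :
    grad (c • F) p = c • grad F p := by
  have hp := ne_zero_of_mem_unit_sphere p
  rw [grad, gradient, radialExtension_const_smul, fderiv_const_smul (hF.differentiableAt hp),
    map_smul]
  rfl

theorem hess_add {F G : C(S2, ℝ)} (hF : IsSmooth F) (hG : IsSmooth G) (p : S2) (u v : E3) :
    hess (F + G) p u v = hess F p u v + hess G p u v := by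
  have hp := ne_zero_of_mem_unit_sphere p
  have h : fderiv ℝ (radialExtension (F + G)) =ᶠ[𝓝 (p : E3)]
      fderiv ℝ (radialExtension F) + fderiv ℝ (radialExtension G) := by
    filter_upwards [isOpen_compl_singleton.mem_nhds hp] with x hx
    rw [radialExtension_add, fderiv_add (hF.differentiableAt hx) (hG.differentiableAt hx)]
    rfl
  rw [hess, h.fderiv_eq, fderiv_add (hF.differentiableAt_fderiv hp)
    (hG.differentiableAt_fderiv hp)]
  rfl

theorem hess_eq {F : C(S2, ℝ)} (hF : IsSmooth F) (p : S2) (u v : E3) :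
    hess F p u v = fderiv ℝ (fun x => fderiv ℝ (radialExtension F) x v) p u := by
  have hp := ne_zero_of_mem_unit_sphere p
  rw [hess, fderiv_clm_apply (hF.differentiableAt_fderiv hp) (differentiableAt_const v)]
  simp

/-! ### Linear functions -/

/-- The restriction to the sphere of a linear function. -/
noncomputable def linearFun (a : E3) : C(S2, ℝ) := restrictSphere (fun x => inner ℝ a x) (by fun_prop)

theorem isSmooth_linearFun (a : E3) : IsSmooth (linearFun a) :=
  isSmooth_restrictSphere (Q := fun x => inner ℝ a x) (innerSL ℝ a).contDiff

theorem norm_linearFun_le (a : E3) : ‖linearFun a‖ ≤ ‖a‖ := by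
  rw [ContinuousMap.norm_le _ (norm_nonneg a)]
  intro p
  refine (abs_real_inner_le_norm a p).trans ?_
  rw [norm_eq_of_mem_sphere p, mul_one]

theorem radialExtension_linearFun (a x : E3) :
    radialExtension (linearFun a) x = ‖x‖⁻¹ * inner ℝ a x := by
  by_cases hx : x = 0
  · simp [radialExtension, hx]
  · rw [radialExtension_apply _ hx]
    simp [linearFun, restrictSphere, inner_smul_right]

theorem hasFDerivAt_norm_inv {x : E3} (hx : x ≠ 0) :
    HasFDerivAt (fun y : E3 => ‖y‖⁻¹) (-(‖x‖⁻¹ ^ 3) • innerSL ℝ x) x := by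
  have h1 : HasFDerivAt (fun y : E3 => ‖y‖) (‖x‖⁻¹ • innerSL ℝ x) x := by
    have h := (hasStrictFDerivAt_norm_sq x).hasFDerivAt.sqrt (by positivity)
    simp only [Real.sqrt_sq (norm_nonneg _)] at h
    convert! h using 1
    ext y
    simp
    field_simp
  have h2 := (hasDerivAt_inv (norm_ne_zero_iff.2 hx)).comp_hasFDerivAt x h1
  convert! h2 using 1
  rw [smul_smul]
  congr 1
  have := norm_ne_zero_iff.2 hx
  field_simp

theorem hasFDerivAt_normalize {x : E3} (hx : x ≠ 0) : ∃ L : E3 →L[ℝ] E3,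
    HasFDerivAt (fun y : E3 => ‖y‖⁻¹ • y) L x ∧
    ∀ u, L u = ‖x‖⁻¹ • u - (‖x‖⁻¹ ^ 3 * inner ℝ x u) • x := by
  refine ⟨_, (hasFDerivAt_norm_inv hx).smul (hasFDerivAt_id x), fun u => ?_⟩
  simp [sub_eq_add_neg]

theorem fderiv_radialExtension_linearFun (a : E3) {x : E3} (hx : x ≠ 0) (v : E3) :
    fderiv ℝ (radialExtension (linearFun a)) x v =
      ‖x‖⁻¹ * inner ℝ a v - ‖x‖⁻¹ ^ 3 * (inner ℝ x v * inner ℝ a x) := by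
  have h : radialExtension (linearFun a) = fun x => ‖x‖⁻¹ * innerSL ℝ a x := by
    funext y
    rw [radialExtension_linearFun]
    rfl
  have h1 := (hasFDerivAt_norm_inv hx).mul (innerSL ℝ a).hasFDerivAt
  rw [h, HasFDerivAt.fderiv (f := fun x => ‖x‖⁻¹ * innerSL ℝ a x) h1]
  simp
  ring

theorem grad_linearFun (a : E3) (p : S2) :
    grad (linearFun a) p = a - (inner ℝ a (p : E3)) • (p : E3) := by
  refine ext_inner_right ℝ fun v => ?_
  rw [grad, gradient, InnerProductSpace.toDual_symm_apply,
    fderiv_radialExtension_linearFun a (ne_zero_of_mem_unit_sphere p), norm_eq_of_mem_sphere,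
    inner_sub_left, inner_smul_left]
  simp
  ring

theorem hess_linearFun (a : E3) (p : S2) {u v : E3} (hu : inner ℝ (p : E3) u = 0)
    (hv : inner ℝ (p : E3) v = 0) :
    hess (linearFun a) p u v = -(inner ℝ a (p : E3) * inner ℝ u v) := by
  have hp := ne_zero_of_mem_unit_sphere p
  have h : (fun x => fderiv ℝ (radialExtension (linearFun a)) x v) =ᶠ[𝓝 (p : E3)]
      fun x => ‖x‖⁻¹ * inner ℝ a v - ‖x‖⁻¹ ^ 3 * (innerSL ℝ v x * innerSL ℝ a x) := by
    filter_upwards [isOpen_compl_singleton.mem_nhds hp] with x hx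
    rw [fderiv_radialExtension_linearFun a hx, real_inner_comm v x]
    rfl
  rw [hess_eq (isSmooth_linearFun a), h.fderiv_eq]
  have hn := hasFDerivAt_norm_inv hp
  have h1 := (hn.mul_const (inner ℝ a v)).sub
    ((hn.pow 3).mul ((innerSL ℝ v).hasFDerivAt.mul (innerSL ℝ a).hasFDerivAt))
  rw [HasFDerivAt.fderiv (f := fun x =>
    ‖x‖⁻¹ * inner ℝ a v - ‖x‖⁻¹ ^ 3 * (innerSL ℝ v x * innerSL ℝ a x)) h1]
  have hv' : inner ℝ v (p : E3) = 0 := by rw [real_inner_comm, hv]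
  simp [hu, hv', norm_eq_of_mem_sphere p, real_inner_comm u v]

/-! ### Perturbation to nondegenerate critical points -/

/-- The map whose regular values `a` make the critical points of `F + ⟪a, ·⟫` nondegenerate. -/
noncomputable def endpointMap (F : C(S2, ℝ)) (x : E3) : E3 :=
  -gradient (radialExtension F) (‖x‖⁻¹ • x) + ((‖x‖ - 2) * ‖x‖⁻¹) • x

theorem IsSmooth.differentiableAt_endpointMap {F : C(S2, ℝ)} (hF : IsSmooth F) {x : E3}
    (hx : x ≠ 0) : DifferentiableAt ℝ (endpointMap F) x := by
  obtain ⟨L, hL, -⟩ := hasFDerivAt_normalize hx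
  have hn : ‖x‖⁻¹ • x ≠ 0 := smul_ne_zero (inv_ne_zero (norm_ne_zero_iff.2 hx)) hx
  have hd : DifferentiableAt ℝ (fun y : E3 => ‖y‖) x := (contDiffAt_norm ℝ hx).differentiableAt
    (n := 1) one_ne_zero
  have h1 : DifferentiableAt ℝ (fun y : E3 => gradient (radialExtension F) (‖y‖⁻¹ • y)) x :=
    DifferentiableAt.comp (g := gradient (radialExtension F)) x (hF.differentiableAt_gradient hn) hL.differentiableAt
  exact h1.neg.add (((hd.sub_const 2).mul (hasFDerivAt_norm_inv hx).differentiableAt).smul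
    differentiableAt_id)

/-- Sard's theorem between spaces of equal dimension: critical values are null, so regular values
come arbitrarily close to 0. -/
theorem IsSmooth.exists_regular_value {F : C(S2, ℝ)} (hF : IsSmooth F) {ε : ℝ} (hε : 0 < ε) :
    ∃ a : E3, ‖a‖ < ε ∧ ∀ x ≠ 0, endpointMap F x = a → (fderiv ℝ (endpointMap F) x).det ≠ 0 := by
  set s : Set E3 := {x | x ≠ 0 ∧ (fderiv ℝ (endpointMap F) x).det = 0}
  have h0 : volume (endpointMap F '' s) = 0 :=
    addHaar_image_eq_zero_of_det_fderivWithin_eq_zero volume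
      (fun x hx => (hF.differentiableAt_endpointMap hx.1).hasFDerivAt.hasFDerivWithinAt)
      (fun x hx => hx.2)
  have hdense : Dense {a | a ∉ endpointMap F '' s} :=
    Measure.dense_of_ae (measure_eq_zero_iff_ae_notMem.1 h0)
  obtain ⟨a, ha, has⟩ := hdense.exists_mem_open Metric.isOpen_ball
    ⟨(0 : E3), Metric.mem_ball_self hε⟩
  refine ⟨a, by simpa using has, fun x hx hxa hdet => ha ⟨x, ⟨hx, hdet⟩, hxa⟩⟩

section Perturbation

variable {F : C(S2, ℝ)} {a : E3}

theorem two_add_inner_pos (ha : ‖a‖ < 1) (p : S2) : 0 < 2 + inner ℝ a (p : E3) := by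
  have h := abs_real_inner_le_norm a (p : E3)
  rw [norm_eq_of_mem_sphere p, mul_one] at h
  linarith [(abs_le.1 h).1]

theorem norm_smul_coe {r : ℝ} (hr : 0 < r) (p : S2) : ‖r • (p : E3)‖ = r := by
  rw [norm_smul, norm_eq_of_mem_sphere, mul_one, Real.norm_eq_abs, abs_of_pos hr]

theorem endpointMap_smul {r : ℝ} (hr : 0 < r) (p : S2) :
    endpointMap F (r • (p : E3)) = -grad F p + (r - 2) • (p : E3) := by
  rw [endpointMap, norm_smul_coe hr, smul_smul, smul_smul, inv_mul_cancel₀ hr.ne', one_smul,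
    mul_assoc, inv_mul_cancel₀ hr.ne', mul_one]
  rfl

/-- Criticality says that the tangential part of `a` is −grad F(p); the normal part of `a` is stored
in the radius 2 + ⟨a, p⟩. The shift by 2 keeps this radius positive when ‖a‖ < 1. -/
theorem IsSmooth.isCritical_add_linearFun_iff (hF : IsSmooth F) (ha : ‖a‖ < 1) (p : S2) :
    IsCritical (F + linearFun a) p ↔
      endpointMap F ((2 + inner ℝ a (p : E3)) • (p : E3)) = a := by
  rw [endpointMap_smul (two_add_inner_pos ha p), IsCritical, grad_add hF (isSmooth_linearFun a),
    grad_linearFun, ← sub_eq_zero (b := a), ← neg_eq_zero (a := _ - a), add_sub_cancel_left]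
  rw [show -(-grad F p + inner ℝ a (p : E3) • (p : E3) - a) =
    grad F p + (a - inner ℝ a (p : E3) • (p : E3)) by abel]

/-- Critical points inject continuously into the fibre of `endpointMap F` over `a`, which is
discrete where the derivative is invertible. -/
theorem IsSmooth.isolated_add_linearFun (hF : IsSmooth F) (ha : ‖a‖ < 1)
    (hreg : ∀ x ≠ 0, endpointMap F x = a → (fderiv ℝ (endpointMap F) x).det ≠ 0) (p : S2)
    (hp : IsCritical (F + linearFun a) p) :
    ∀ᶠ q in 𝓝[≠] p, ¬ IsCritical (F + linearFun a) q := by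
  set x : S2 → E3 := fun q => (2 + inner ℝ a (q : E3)) • (q : E3) with hx
  have hxne : x p ≠ 0 := smul_ne_zero (two_add_inner_pos ha p).ne' (ne_zero_of_mem_unit_sphere p)
  have hxp := (hF.isCritical_add_linearFun_iff ha p).1 hp
  have hinj : Function.Injective x := by
    intro q q' h
    have hn := congrArg norm h
    simp only [hx] at h hn
    rw [norm_smul_coe (two_add_inner_pos ha q), norm_smul_coe (two_add_inner_pos ha q')] at hn
    rw [hn] at h
    exact Subtype.ext (smul_right_injective E3 (two_add_inner_pos ha q').ne' h)
  have hcont : ContinuousAt x p := by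
    have : Continuous x := by fun_prop
    exact this.continuousAt
  set e := (fderiv ℝ (endpointMap F) (x p)).toContinuousLinearEquivOfDetNeZero (hreg _ hxne hxp)
  have hev : ∀ᶠ z in 𝓝[≠] (x p), endpointMap F z ≠ a :=
    (hF.differentiableAt_endpointMap hxne).hasFDerivAt.eventually_ne
      ⟨_, e.antilipschitz⟩
  have htend : Filter.Tendsto x (𝓝[≠] p) (𝓝[≠] (x p)) :=
    tendsto_nhdsWithin_of_tendsto_nhds_of_eventually_within _
      (hcont.tendsto.mono_left nhdsWithin_le_nhds)
      (eventually_mem_nhdsWithin.mono fun q hq h => hq (hinj h))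
  filter_upwards [htend.eventually hev] with q hq hc
  exact hq ((hF.isCritical_add_linearFun_iff ha q).1 hc)

theorem IsSmooth.fderiv_endpointMap_radial (hF : IsSmooth F) {r : ℝ} (hr : 0 < r) (p : S2) :
    fderiv ℝ (endpointMap F) (r • (p : E3)) p = p := by
  have hxne : r • (p : E3) ≠ 0 := smul_ne_zero hr.ne' (ne_zero_of_mem_unit_sphere p)
  have h1 : HasDerivAt (fun s : ℝ => s • (p : E3)) (p : E3) r := by
    simpa using (hasDerivAt_id r).smul_const (p : E3)
  have h2 := (hF.differentiableAt_endpointMap hxne).hasFDerivAt.comp_hasDerivAt r h1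
  refine h2.unique ?_
  have h3 : HasDerivAt (fun s : ℝ => -grad F p + (s - 2) • (p : E3)) (p : E3) r := by
    simpa using (((hasDerivAt_id r).sub_const 2).smul_const (p : E3)).const_add (-grad F p)
  refine h3.congr_of_eventuallyEq ?_
  filter_upwards [lt_mem_nhds hr] with s hs
  exact endpointMap_smul hs p

/-- At radius r = 2 + ⟨a, p⟩ the right-hand side is −1/r times the Hessian of `F + linearFun a`,
which links regularity to nondegeneracy. -/
theorem IsSmooth.inner_fderiv_endpointMap (hF : IsSmooth F) {r : ℝ} (hr : 0 < r) (p : S2)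
    {u v : E3} (hu : inner ℝ (p : E3) u = 0) (hv : inner ℝ (p : E3) v = 0) :
    inner ℝ v (fderiv ℝ (endpointMap F) (r • (p : E3)) u) =
      r⁻¹ * (-hess F p u v + (r - 2) * inner ℝ u v) := by
  set x := r • (p : E3) with hx
  have hxnorm : ‖x‖ = r := norm_smul_coe hr p
  have hxne : x ≠ 0 := smul_ne_zero hr.ne' (ne_zero_of_mem_unit_sphere p)
  have hNx : ‖x‖⁻¹ • x = p := by
    rw [hxnorm, hx, smul_smul, inv_mul_cancel₀ hr.ne', one_smul]
  have hxu : inner ℝ x u = 0 := by rw [hx, inner_smul_left, hu, mul_zero]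
  have hvx : inner ℝ v x = 0 := by rw [hx, inner_smul_right, real_inner_comm, hv, mul_zero]
  have h1 := (innerSL ℝ v).hasFDerivAt.comp x (hF.differentiableAt_endpointMap hxne).hasFDerivAt
  obtain ⟨L, hL, hLu⟩ := hasFDerivAt_normalize hxne
  have hp := ne_zero_of_mem_unit_sphere p
  have hG : DifferentiableAt ℝ (fun y => fderiv ℝ (radialExtension F) y v) (‖x‖⁻¹ • x) := by
    rw [hNx]
    exact (hF.differentiableAt_fderiv hp).clm_apply (differentiableAt_const v)
  have hd : DifferentiableAt ℝ (fun y : E3 => (‖y‖ - 2) * ‖y‖⁻¹) x :=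
    (((contDiffAt_norm ℝ hxne).differentiableAt (n := 1) one_ne_zero).sub_const 2).mul
      (hasFDerivAt_norm_inv hxne).differentiableAt
  have h2 := (HasFDerivAt.comp (f := fun y : E3 => ‖y‖⁻¹ • y) x hG.hasFDerivAt hL).neg.add
    (hd.hasFDerivAt.mul (innerSL ℝ v).hasFDerivAt)
  have hfun : (fun y => innerSL ℝ v (endpointMap F y)) = fun y =>
      -(fderiv ℝ (radialExtension F) (‖y‖⁻¹ • y) v) + ((‖y‖ - 2) * ‖y‖⁻¹) * innerSL ℝ v y := by
    funext y
    simp only [endpointMap, map_add, map_neg, map_smul, smul_eq_mul, innerSL_apply_apply]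
    rw [gradient, real_inner_comm, InnerProductSpace.toDual_symm_apply]
  have h3 := (h1.congr_of_eventuallyEq (f₁ := fun y =>
      -(fderiv ℝ (radialExtension F) (‖y‖⁻¹ • y) v) + ((‖y‖ - 2) * ‖y‖⁻¹) * innerSL ℝ v y)
      (Filter.Eventually.of_forall fun y => (congrFun hfun y).symm)).unique h2
  have h4 := congrArg (fun T : E3 →L[ℝ] ℝ => T u) h3
  simp only [ContinuousLinearMap.comp_apply, innerSL_apply_apply, add_apply,
    neg_apply, smul_apply, smul_eq_mul, hLu, hxu, hvx,
    mul_zero, zero_smul, sub_zero, add_zero, map_smul] at h4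
  rw [h4, hNx, hxnorm, hess_eq hF, real_inner_comm u v]
  ring

/-- A tangent vector `u` in the kernel of the Hessian has `D u` = l p, while `D p` = p. So u − l p
is killed by the invertible `D`, and tangency of `u` forces l = 0. -/
theorem IsSmooth.nondegenerate_add_linearFun (hF : IsSmooth F) (ha : ‖a‖ < 1)
    (hreg : ∀ x ≠ 0, endpointMap F x = a → (fderiv ℝ (endpointMap F) x).det ≠ 0) (p : S2)
    (hp : IsCritical (F + linearFun a) p) (u : E3) (hu : inner ℝ (p : E3) u = 0)
    (hker : ∀ v : E3, inner ℝ (p : E3) v = 0 → hess (F + linearFun a) p u v = 0) : u = 0 := by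
  set r := 2 + inner ℝ a (p : E3) with hr
  have hrpos : 0 < r := two_add_inner_pos ha p
  have hxne : r • (p : E3) ≠ 0 := smul_ne_zero hrpos.ne' (ne_zero_of_mem_unit_sphere p)
  have hdet := hreg _ hxne ((hF.isCritical_add_linearFun_iff ha p).1 hp)
  set D := fderiv ℝ (endpointMap F) (r • (p : E3)) with hD
  have hpp : inner ℝ (p : E3) (p : E3) = (1 : ℝ) := by
    rw [real_inner_self_eq_norm_sq, norm_eq_of_mem_sphere, one_pow]
  set l : ℝ := inner ℝ (p : E3) (D u) with hl
  have hDu : D u = l • (p : E3) := by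
    have hperp : inner ℝ (p : E3) (D u - l • (p : E3)) = 0 := by
      rw [inner_sub_right, inner_smul_right, hpp, mul_one, sub_self]
    rw [← sub_eq_zero, ← inner_self_eq_zero (𝕜 := ℝ)]
    have hsplit : ∀ w : E3, inner ℝ w (D u - l • (p : E3)) =
        inner ℝ w (D u) - l * inner ℝ (p : E3) w := fun w => by
      rw [inner_sub_right, inner_smul_right, real_inner_comm w]
    rw [hsplit, hperp, mul_zero, sub_zero, hF.inner_fderiv_endpointMap hrpos p hu hperp]
    have h := hker _ hperp
    rw [hess_add hF (isSmooth_linearFun a), hess_linearFun a p hu hperp] at h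
    rw [hr, add_sub_cancel_left]
    refine mul_eq_zero_of_right _ ?_
    linarith
  have hDp : D p = p := hF.fderiv_endpointMap_radial hrpos p
  have h0 : D (u - l • (p : E3)) = 0 := by
    rw [map_sub, map_smul, hDu, hDp, sub_self]
  have h1 : u - l • (p : E3) = 0 :=
    (D.toContinuousLinearEquivOfDetNeZero hdet).injective (h0.trans (map_zero _).symm)
  have h2 : l = 0 := by
    have := congrArg (inner ℝ (p : E3)) h1
    rw [inner_sub_right, inner_smul_right, hpp, hu, inner_zero_right] at this
    linarith
  rwa [h2, zero_smul, sub_zero] at h1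

end Perturbation

end MedianSphere

namespace MedianSphere

open Set

/-! ### Separating the critical values -/

theorem radialExtension_eventually_eq {χ : C(S2, ℝ)} {p : S2} {c : ℝ}
    (h : ∀ᶠ q in 𝓝 p, χ q = c) : radialExtension χ =ᶠ[𝓝 (p : E3)] fun _ => c := by
  have hp := ne_zero_of_mem_unit_sphere p
  obtain ⟨U, hU, hUo, hpU⟩ := eventually_nhds_iff.1 h
  obtain ⟨V, hVo, rfl⟩ := isOpen_induced_iff.1 hUo
  have hcont : ContinuousAt (fun x : E3 => ‖x‖⁻¹ • x) p :=
    (hasFDerivAt_normalize hp).choose_spec.1.continuousAt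
  have hV : ∀ᶠ x in 𝓝 (p : E3), ‖x‖⁻¹ • x ∈ V := by
    refine hcont.eventually_mem (hVo.mem_nhds ?_)
    rwa [norm_eq_of_mem_sphere, inv_one, one_smul]
  filter_upwards [hV, isOpen_compl_singleton.mem_nhds hp] with x hx hx0
  rw [radialExtension_apply χ hx0]
  exact hU _ hx

theorem grad_eq_zero_of_eventually_eq {χ : C(S2, ℝ)} {p : S2} {c : ℝ}
    (h : ∀ᶠ q in 𝓝 p, χ q = c) : grad χ p = 0 := by
  rw [grad, gradient, (radialExtension_eventually_eq h).fderiv_eq]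
  simp

theorem hess_eq_zero_of_eventually_eq {χ : C(S2, ℝ)} {p : S2} {c : ℝ}
    (h : ∀ᶠ q in 𝓝 p, χ q = c) (u v : E3) : hess χ p u v = 0 := by
  rw [hess, (radialExtension_eventually_eq h).fderiv.fderiv_eq]
  simp

/-- A sum of bumps with disjoint supports and distinct heights; multiples of it shift critical
values independently. -/
theorem exists_smooth_locally_injective_const (Z : Finset S2) :
    ∃ χ : C(S2, ℝ), IsSmooth χ ∧ (∀ z ∈ Z, ∀ᶠ q in 𝓝 z, χ q = χ z) ∧
      ∀ z ∈ Z, ∀ w ∈ Z, χ z = χ w → z = w := by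
  obtain ⟨e, he⟩ : ∃ e : S2 → ℝ, ∀ z ∈ Z, ∀ w ∈ Z, e z = e w → z = w := by
    classical
    refine ⟨fun z => if h : z ∈ Z then ((Z.equivFin ⟨z, h⟩ : ℕ) : ℝ) else 0, ?_⟩
    intro z hz w hw h
    simp only [hz, hw, dif_pos, Nat.cast_inj] at h
    exact congrArg Subtype.val (Z.equivFin.injective (Fin.ext h))
  obtain ⟨U, hU, hd⟩ := ((Z.finite_toSet).image (Subtype.val : S2 → E3)).t2_separation
  have hball : ∀ z : S2, ∃ f : ContDiffBump (z : E3), Metric.closedBall (z : E3) f.rOut ⊆ U z := by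
    intro z
    obtain ⟨r, hr, hrU⟩ := Metric.nhds_basis_closedBall.mem_iff.1 ((hU z).2.mem_nhds (hU z).1)
    exact ⟨⟨r / 2, r, half_pos hr, half_lt_self hr⟩, hrU⟩
  choose f hf using hball
  have hsmooth : ContDiff ℝ ∞ fun x : E3 => ∑ z ∈ Z, e z * f z x :=
    ContDiff.sum fun z _ => contDiff_const.mul (f z).contDiff
  have hval : ∀ z ∈ Z, ∀ᶠ q : S2 in 𝓝 z, restrictSphere _ hsmooth.continuous q = e z := by
    intro z hz
    have h1 : ∀ᶠ x : E3 in 𝓝 (z : E3), ∑ w ∈ Z, e w * f w x = e z := by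
      filter_upwards [(f z).eventuallyEq_one, (hU z).2.mem_nhds (hU z).1] with x hx hxU
      rw [Finset.sum_eq_single_of_mem z hz, hx, Pi.one_apply, mul_one]
      intro w hw hwz
      rw [(f w).zero_of_le_dist, mul_zero]
      by_contra! hlt
      refine Set.disjoint_left.1 (hd ⟨w, hw, rfl⟩ ⟨z, hz, rfl⟩ fun h => hwz (Subtype.ext h))
        (hf w (Metric.mem_closedBall.2 hlt.le)) hxU
    exact continuous_subtype_val.continuousAt.eventually h1
  refine ⟨restrictSphere _ hsmooth.continuous, isSmooth_restrictSphere hsmooth, ?_, ?_⟩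
  · intro z hz
    rw [(hval z hz).self_of_nhds]
    exact hval z hz
  · intro z hz w hw h
    rw [(hval z hz).self_of_nhds, (hval w hw).self_of_nhds] at h
    exact he z hz w hw h

theorem finite_isCritical {F : C(S2, ℝ)}
    (hiso : ∀ p, IsCritical F p → ∀ᶠ q in 𝓝[≠] p, ¬ IsCritical F q)
    (hF : IsSmooth F) : {p | IsCritical F p}.Finite := by
  by_contra hinf
  have hcl : IsClosed {p | IsCritical F p} := isClosed_singleton.preimage hF.continuous_grad
  obtain ⟨p, hp, hacc⟩ := Set.Infinite.exists_accPt_of_subset_isCompact hinf hcl.isCompact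
    subset_rfl
  rw [accPt_iff_frequently_nhdsNE] at hacc
  exact hacc (hiso p hp)

/-- Adding sχ changes neither gradient nor Hessian at the critical points. Where χ is not locally
flat the gradient of `F` is bounded below, so a small `s` creates no new critical point. -/
theorem IsSmooth.exists_isGeneric_near {F : C(S2, ℝ)} (hF : IsSmooth F)
    (hiso : ∀ p, IsCritical F p → ∀ᶠ q in 𝓝[≠] p, ¬ IsCritical F q)
    (hnd : ∀ p, IsCritical F p → ∀ u : E3, inner ℝ (p : E3) u = 0 →
      (∀ v : E3, inner ℝ (p : E3) v = 0 → hess F p u v = 0) → u = 0) {ε : ℝ} (hε : 0 < ε) :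
    ∃ G, IsGeneric G ∧ ‖G - F‖ < ε := by
  have hfin := finite_isCritical hiso hF
  obtain ⟨χ, hχ, hloc, hinj⟩ := exists_smooth_locally_injective_const hfin.toFinset
  simp only [Set.Finite.mem_toFinset, Set.mem_ofPred_eq] at hloc hinj
  set V : Set S2 := interior {q | grad χ q = 0} with hV
  have hZV : ∀ z, IsCritical F z → z ∈ V := by
    intro z hz
    rw [hV, mem_interior_iff_mem_nhds]
    filter_upwards [eventually_eventually_nhds.2 (hloc z hz)] with q hq
    exact grad_eq_zero_of_eventually_eq hq
  have hVc : IsCompact Vᶜ := isOpen_interior.isClosed_compl.isCompact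
  obtain ⟨c, hc, hcF⟩ : ∃ c > 0, ∀ q ∈ Vᶜ, c ≤ ‖grad F q‖ := by
    rcases Vᶜ.eq_empty_or_nonempty with h | h
    · exact ⟨1, one_pos, fun q hq => absurd (h ▸ hq) (Set.notMem_empty q)⟩
    · obtain ⟨q₀, hq₀, hmin⟩ := hVc.exists_isMinOn h hF.continuous_grad.norm.continuousOn
      exact ⟨‖grad F q₀‖, norm_pos_iff.2 fun h0 => hq₀ (hZV q₀ h0), fun q hq => hmin hq⟩
  obtain ⟨M, hM⟩ := (isCompact_range hχ.continuous_grad).isBounded.exists_norm_le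
  have hM0 : 0 ≤ M := (norm_nonneg _).trans
    (hM _ (mem_range_self (Classical.arbitrary S2)))
  set δ := min (c / (M + 1)) (ε / (‖χ‖ + 1)) with hδ
  have hδ0 : 0 < δ := by positivity
  -- The finitely many `s` for which two critical values of F + sχ collide.
  have hbad : ((fun w : S2 × S2 => (F w.2 - F w.1) / (χ w.1 - χ w.2)) ''
      ({p | IsCritical F p} ×ˢ {p | IsCritical F p})).Finite := (hfin.prod hfin).image _
  obtain ⟨s, ⟨hs0, hsδ⟩, hs⟩ := (Set.Ioo_infinite hδ0).exists_notMem_finite hbad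
  have hsχ := hχ.const_smul s
  have hgrad : ∀ q, grad (F + s • χ) q = grad F q + s • grad χ q := fun q => by
    rw [grad_add hF hsχ, grad_const_smul hχ]
  have hcrit : ∀ q, IsCritical (F + s • χ) q ↔ IsCritical F q := by
    intro q
    by_cases hq : q ∈ V
    · have : grad χ q = 0 := interior_subset (s := {q | grad χ q = 0}) hq
      rw [IsCritical, hgrad, this, smul_zero, add_zero, IsCritical]
    · have hFq := hcF q hq
      have hlt : ‖s • grad χ q‖ < c := by
        rw [norm_smul, Real.norm_eq_abs, abs_of_pos hs0]
        have h1 : ‖grad χ q‖ ≤ M := hM _ (mem_range_self q)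
        have h2 : s < c / (M + 1) := hsδ.trans_le (min_le_left _ _)
        rw [lt_div_iff₀ (by positivity)] at h2
        nlinarith
      refine iff_of_false (fun h => ?_) (fun h => hq (hZV q h))
      rw [IsCritical, hgrad, add_eq_zero_iff_eq_neg] at h
      rw [h, norm_neg] at hFq
      linarith
  refine ⟨F + s • χ, ⟨hF.add hsχ, ?_, ?_, ?_⟩, ?_⟩
  · intro p hp
    simp only [hcrit] at hp ⊢
    exact hiso p hp
  · intro p hp u hu h
    rw [hcrit] at hp
    refine hnd p hp u hu fun v hv => ?_
    have hcs : ∀ᶠ q in 𝓝 p, (s • χ) q = s * χ p := by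
      filter_upwards [hloc p hp] with q hq
      simp [hq]
    rw [← h v hv, hess_add hF hsχ, hess_eq_zero_of_eventually_eq hcs, add_zero]
  · intro p q hp hq hpq
    rw [hcrit] at hp hq
    by_contra hne
    have hχne : χ p - χ q ≠ 0 := fun h => hne (hinj p hp q hq (sub_eq_zero.1 h))
    refine hs ⟨(p, q), ⟨hp, hq⟩, ?_⟩
    simp only [ContinuousMap.add_apply, ContinuousMap.smul_apply, smul_eq_mul] at hpq
    rw [div_eq_iff hχne]
    linarith
  · rw [add_sub_cancel_left, norm_smul, Real.norm_eq_abs, abs_of_pos hs0]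
    have h2 : s < ε / (‖χ‖ + 1) := hsδ.trans_le (min_le_right _ _)
    rw [lt_div_iff₀ (by positivity)] at h2
    nlinarith [norm_nonneg χ]

theorem dense_isGeneric : Dense {F : C(S2, ℝ) | IsGeneric F} := by
  rw [Metric.dense_iff]
  intro F ε hε
  obtain ⟨F₁, hF₁, h₁⟩ := Metric.dense_iff.1 dense_isSmooth F (ε / 3) (by positivity)
  have hF₁' : IsSmooth F₁ := h₁
  obtain ⟨a, ha, hreg⟩ := hF₁'.exists_regular_value (ε := min 1 (ε / 3)) (by positivity)
  have ha1 : ‖a‖ < 1 := ha.trans_le (min_le_left _ _)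
  obtain ⟨G, hG, hGF⟩ := (hF₁'.add (isSmooth_linearFun a)).exists_isGeneric_near
    (hF₁'.isolated_add_linearFun ha1 hreg) (hF₁'.nondegenerate_add_linearFun ha1 hreg)
    (ε := ε / 3) (by positivity)
  refine ⟨G, ?_, hG⟩
  rw [Metric.mem_ball, dist_eq_norm] at hF₁ ⊢
  have h2 : ‖linearFun a‖ < ε / 3 :=
    (norm_linearFun_le a).trans_lt (ha.trans_le (min_le_right _ _))
  calc ‖G - F‖ = ‖(G - (F₁ + linearFun a)) + linearFun a + (F₁ - F)‖ := by congr 1; abel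
    _ ≤ ‖G - (F₁ + linearFun a)‖ + ‖linearFun a‖ + ‖F₁ - F‖ := norm_add₃_le
    _ < ε := by linarith

theorem IsMedianExtension.eq_medianValue {ζ : C(S2, ℝ) → ℝ} (h : IsMedianExtension ζ) :
    ζ = medianValue := by
  refine Continuous.ext_on dense_isGeneric h.continuous continuous_medianValue fun F hF => ?_
  obtain ⟨m, hm, -⟩ := existsUnique_isMedian F
  obtain ⟨p, rfl⟩ := (isQuotientMap_toReeb F).surjective m
  rw [h.value F hF p hm, medianValue_eq_of_isMedian hm]

end MedianSphere

/-! ### The main theorem -/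

theorem mainTheorem1 :
    (∀ F : C(MedianSphere.S2, ℝ), MedianSphere.IsGeneric F →
      ∃! m : MedianSphere.ReebGraph F, MedianSphere.IsMedian F m) ∧
    (∃! ζ : C(MedianSphere.S2, ℝ) → ℝ, MedianSphere.IsMedianExtension ζ) ∧
    (∀ ζ : C(MedianSphere.S2, ℝ) → ℝ, MedianSphere.IsMedianExtension ζ →
      MedianSphere.IsQuasiState ζ ∧
      Monotone ζ ∧
      (∀ F G : C(MedianSphere.S2, ℝ), |ζ F - ζ G| ≤ ‖F - G‖) ∧
      ¬ IsLinearMap ℝ ζ ∧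
      ζ (MedianSphere.coord 0 ^ 2 + MedianSphere.coord 1 ^ 2)
        - ζ (MedianSphere.coord 0 ^ 2) - ζ (MedianSphere.coord 1 ^ 2) = 1) := by
  refine ⟨fun F _ => MedianSphere.existsUnique_isMedian F,
    ⟨MedianSphere.medianValue, MedianSphere.isMedianExtension_medianValue,
      fun ζ hζ => MedianSphere.IsMedianExtension.eq_medianValue hζ⟩, fun ζ hζ => ?_⟩
  obtain rfl := MedianSphere.IsMedianExtension.eq_medianValue hζ
  have hval : MedianSphere.medianValue (MedianSphere.coord 0 ^ 2 + MedianSphere.coord 1 ^ 2)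
      - MedianSphere.medianValue (MedianSphere.coord 0 ^ 2)
      - MedianSphere.medianValue (MedianSphere.coord 1 ^ 2) = 1 := by
    rw [MedianSphere.medianValue_coord_sq_add, MedianSphere.medianValue_coord_sq,
      MedianSphere.medianValue_coord_sq]
    norm_num
  refine ⟨MedianSphere.isQuasiState_medianValue, MedianSphere.medianValue_mono,
    MedianSphere.abs_medianValue_sub_le, fun hlin => ?_, hval⟩
  rw [hlin.map_add] at hval
  norm_num at hval
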